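/- For each sample size $n$ let $p=p_n\ge 1$, let $\Sigma^*=\Sigma^*_n$ be a positive definite $p\times p$ covariance matrix with inverse $\Omega^*$, and let $X^n=(X_1,\dots,X_n)$ be i.i.d. from $N(0,\Sigma^*)$. All limits are as $n\to\infty$, $o_P(1)$ refers to the law of $X^n$, $\|\cdot\|$ is the spectral norm and $\|\cdot\|_F$ the Frobenius norm. Let $\hat\Sigma=\frac1n\sum_{i=1}^nX_iX_i^T$ and $l_n(\Omega)=\frac n2\log\det(\Omega)-\frac n2\mathrm{tr}(\Omega\hat\Sigma)$. For a prior $\Pi$ on the precision matrix $\Omega=\Sigma^{-1}$ write $$\Pi(B|X^n)=\frac{\int_B\exp(l_n(\Omega))\,d\Pi(\Omega)}{\int\exp(l_n(\Omega))\,d\Pi(\Omega)}.$$ Let $b=b_n\ge1$ be integers and let $\Pi=\mathcal W_p(I,p+b-1)$ be the Wishart prior, i.e. the probability measure on symmetric positive definite $p\times p$ matrices with Lebesgue density proportional to $\exp\big(\frac{b-2}2\log\det(\Omega)-\frac12\mathrm{tr}(\Omega)\big)$. For symmetric matrices $\Phi=\Phi_n\ne0$ and sets $A_n$ of positive definite matrices,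 consider the conditions (C) $A_n\subset\{\|\Sigma-\Sigma^*\|\le\delta_n\}$ for some $\delta_n=o(1)$; $\Pi(A_n|X^n)=1-o_P(1)$; and for every fixed $t\in\mathbb R$, $$\frac{\int_{A_n}\exp(l_n(\Omega_t))\,d\Pi(\Omega)}{\int_{A_n}\exp(l_n(\Omega))\,d\Pi(\Omega)}=1+o_P(1),\qquad \Omega_t=\Omega+\frac{\sqrt2\,t}{\sqrt n\,\|\Sigma^{*1/2}\Phi\Sigma^{*1/2}\|_F}\Phi .$$ For integers $r=r_n\ge1$, symmetric matrices $\Psi=\Psi_n\neq0$ with $\mathrm{rank}(\Psi)\le r$, and sets $A_n$ of positive definite matrices, consider the conditions (P) $A_n\subset\{\sqrt{rp}\,\|\Sigma-\Sigma^*\|\le\delta_n\}$ for some $\delta_n=o(1)$; $\Pi(A_n|X^n)=1-o_P(1)$; and for every fixed $t\in\mathbb R$ the same ratio of integrals is $1+o_P(1)$ with $$\Omega_t=\Omega-\frac{\sqrt2\,t}{\sqrt n\,\|\Omega^{*1/2}\Psi\Omega^{*1/2}\|_F}\Omega^*\Psi\Omega^* .$$ Assume $\|\Sigma^*\|\vee\|\Omega^*\|=O(1)$,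 $p/n=o(1)$ and $b=O(1)$. Then: 1. There are sets $A_n$ such that (C) holds for every such sequence $\Phi$. 2. If in addition $rp^2/n=o(1)$, there are sets $A_n$ such that (P) holds for every such sequence $\Psi$. 3. If moreover $p\to\infty$, there is a constant $M>0$ such that, with the explicit sets $A_n=\{\|\Sigma-\Sigma^*\|\le M\sqrt{p/n}\}$, (C) holds for every such $\Phi$, and (P) holds for every $r$ with $rp^2/n=o(1)$ and every such $\Psi$. -/

import Mathlib

open MeasureTheory ProbabilityTheory Filter Topology Asymptotics
open scoped MatrixOrder Matrix.Norms.L2Operator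

/- Matrix norms `‖·‖` below are spectral norms (the scope `Matrix.Norms.L2Operator`). -/

/-- Real `d × d` matrices. -/
abbrev RMat (d : ℕ) : Type := Matrix (Fin d) (Fin d) ℝ

instance instMeasurableSpaceRMat (d : ℕ) : MeasurableSpace (RMat d) :=
  inferInstanceAs (MeasurableSpace (Fin d → Fin d → ℝ))

/-- The Frobenius norm. -/
noncomputable def frobNorm {d : ℕ} (A : RMat d) : ℝ :=
  Real.sqrt (∑ i, ∑ j, A i j ^ 2)

/-- The symmetric matrix whose entry at the positions `(i, j)` and `(j, i)` is `x s(i, j)`. -/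
def symMatrix {d : ℕ} (x : Sym2 (Fin d) → ℝ) : RMat d :=
  Matrix.of fun i j => x s(i, j)

theorem measurable_symMatrix {d : ℕ} : Measurable (symMatrix (d := d)) :=
  measurable_pi_lambda _ fun i => measurable_pi_lambda _ fun j => measurable_pi_apply s(i, j)

/-- Lebesgue measure `dΩ` on symmetric `d × d` matrices, in the `d (d + 1) / 2` free entries. -/
noncomputable def symLebesgue (d : ℕ) : Measure (RMat d) :=
  (volume : Measure (Sym2 (Fin d) → ℝ)).map symMatrix

/-- The unnormalized Wishart density, supported on the positive definite cone (the positive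
semidefinite cone up to a Lebesgue null set). -/
noncomputable def wishartWeight (d : ℕ) (b : ℤ) : RMat d → ENNReal :=
  Set.indicator {Ω | Ω.PosDef} fun Ω =>
    ENNReal.ofReal (Real.exp (((b : ℝ) - 2) / 2 * Real.log Ω.det - 1 / 2 * Ω.trace))

/-- The Wishart distribution `W_d(I, d + b - 1)`: the normalization of the measure with density
`exp ((b - 2) / 2 * log det Ω - tr Ω / 2)` on symmetric positive definite matrices. -/
noncomputable def wishart (d : ℕ) (b : ℤ) : Measure (RMat d) :=
  (((symLebesgue d).withDensity (wishartWeight d b)) Set.univ)⁻¹ •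
    (symLebesgue d).withDensity (wishartWeight d b)

/-- Samples of size `n` in `ℝ^d`. -/
abbrev Sample (n d : ℕ) : Type := Fin n → EuclideanSpace ℝ (Fin d)

/-- The law of `n` i.i.d. observations from `N(0, S)`. -/
noncomputable def sampleLaw (n : ℕ) {d : ℕ} (S : RMat d) : Measure (Sample n d) :=
  Measure.pi fun _ => multivariateGaussian 0 S

/-- The sample covariance matrix `n⁻¹ ∑ Xᵢ Xᵢᵀ` (the mean is known to be zero). -/
noncomputable def sampleCov {n d : ℕ} (X : Sample n d) : RMat d :=
  (n : ℝ)⁻¹ • ∑ i, Matrix.vecMulVec (X i).ofLp (X i).ofLp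

/-- The Gaussian log-likelihood at the precision matrix `Ω`, up to an additive constant. -/
noncomputable def logLik {n d : ℕ} (X : Sample n d) (Ω : RMat d) : ℝ :=
  (n : ℝ) / 2 * Real.log Ω.det - (n : ℝ) / 2 * (Ω * sampleCov X).trace

/-- The posterior probability of `B` given `X`, for a prior on the precision matrix. -/
noncomputable def posterior {n d : ℕ} (prior : Measure (RMat d)) (X : Sample n d)
    (B : Set (RMat d)) : ℝ :=
  (∫ Ω in B, Real.exp (logLik X Ω) ∂prior) / ∫ Ω, Real.exp (logLik X Ω) ∂prior

/-- The ratio `∫_A exp(l_n(Ω + D)) dΠ(Ω) / ∫_A exp(l_n(Ω)) dΠ(Ω)`. -/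
noncomputable def shiftRatio {n d : ℕ} (prior : Measure (RMat d)) (X : Sample n d)
    (A : Set (RMat d)) (D : RMat d) : ℝ :=
  (∫ Ω in A, Real.exp (logLik X (Ω + D)) ∂prior) / ∫ Ω in A, Real.exp (logLik X Ω) ∂prior

/-- `Y n = c + o_P(1)`, where `Y n` is a statistic of `n` i.i.d. observations from
`N(0, S n)` in dimension `p n`. -/
def TendstoInSampleProb (p : ℕ → ℕ) (S : ∀ n, RMat (p n)) (Y : ∀ n, Sample n (p n) → ℝ)
    (c : ℝ) : Prop :=
  ∀ ε : ℝ, 0 < ε →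
    Tendsto (fun n => sampleLaw n (S n) {X | ε ≤ |Y n X - c|}) atTop (𝓝 0)

/-- The set `{‖Σ - S‖ ≤ ρ}` of precision matrices `Ω = Σ⁻¹`. -/
def covBall {d : ℕ} (S : RMat d) (ρ : ℝ) : Set (RMat d) :=
  {Ω | Ω.PosDef ∧ ‖Ω⁻¹ - S‖ ≤ ρ}

/-- The conditions on the prior and on the sets `A n` for functionals of the covariance matrix
with linearization `Φ`: the `A n` shrink to the truth `S n` in spectral norm; the posterior
concentrates on `A n`; shifting the precision matrix by a multiple of `Φ` is negligible. -/
structure CovarianceConditions (p : ℕ → ℕ) (S : ∀ n, RMat (p n))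
    (prior : ∀ n, Measure (RMat (p n))) (A : ∀ n, Set (RMat (p n)))
    (Φ : ∀ n, RMat (p n)) : Prop where
  shrinking : ∃ δ : ℕ → ℝ, Tendsto δ atTop (𝓝 0) ∧ ∀ n, A n ⊆ covBall (S n) (δ n)
  concentration : TendstoInSampleProb p S (fun n X => posterior (prior n) X (A n)) 1
  shift : ∀ t : ℝ, TendstoInSampleProb p S
    (fun n X => shiftRatio (prior n) X (A n)
      ((Real.sqrt 2 * t /
        (Real.sqrt n * frobNorm (CFC.sqrt (S n) * Φ n * CFC.sqrt (S n)))) • Φ n)) 1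

/-- The conditions on the prior and on the sets `A n` for functionals of the precision matrix
with linearization `Ψ` of rank at most `r`. -/
structure PrecisionConditions (p r : ℕ → ℕ) (S : ∀ n, RMat (p n))
    (prior : ∀ n, Measure (RMat (p n))) (A : ∀ n, Set (RMat (p n)))
    (Ψ : ∀ n, RMat (p n)) : Prop where
  shrinking : ∃ δ : ℕ → ℝ, Tendsto δ atTop (𝓝 0) ∧
    ∀ n, A n ⊆ {Ω | Ω.PosDef ∧ Real.sqrt ((r n : ℝ) * p n) * ‖Ω⁻¹ - S n‖ ≤ δ n}
  concentration : TendstoInSampleProb p S (fun n X => posterior (prior n) X (A n)) 1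
  shift : ∀ t : ℝ, TendstoInSampleProb p S
    (fun n X => shiftRatio (prior n) X (A n)
      (-((Real.sqrt 2 * t /
        (Real.sqrt n * frobNorm (CFC.sqrt (S n)⁻¹ * Ψ n * CFC.sqrt (S n)⁻¹))) •
          ((S n)⁻¹ * Ψ n * (S n)⁻¹)))) 1

/-!
For a Wishart prior the posterior of the precision matrix is again a Wishart law: its density on
the cone of positive definite matrices is proportional to `det Ω ^ a * exp (-tr (Ω G) / 2)` with
`a = (n + b - 2) / 2` and `G = n Σ̂ + 1`.

*Concentration.* The congruence `Ω ↦ A Ω A` has Jacobian `det A ^ (p + 1)`, so the total mass of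
this density is a power of `det G` times a constant (`coneMass_eq`), and the posterior law of each
quadratic form `vᵀ Ω v` has the moment generating function of a chi-squared variable with
`N = n + b + p - 1` degrees of freedom (`lintegral_exp_quadForm_coneWeight`). The constant is finite
already for the prior with `b = 1` (`a = -1/2`), whose density is unbounded at the boundary of the
cone: integrating out one diagonal entry at a time uses that the determinant is affine in that entry
(`lintegral_withDiag_le`). The quadratic forms of `n Σ̂` have the same kind of generating function
under the law of the sample. A Chernoff bound on a net of the unit sphere with `5 ^ p` points
(`exists_finset_norm_le`, `measure_norm_sub_gt_le`) therefore bounds both deviations in spectral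
norm by `2 * 5 ^ p * exp (-c n η ^ 2)`, and when both are small, `Ω⁻¹` is close to the truth
(`mem_covBall_of_norm_le`). Hence the posterior concentrates on balls around the truth of every
radius `ρ` with `ρ → 0`, `n ρ ^ 2 → ∞` and `n ρ ^ 2 ≥ L p` for a suitable constant `L`
(`AdmissibleRadius`).

*Shifts.* In both sets of conditions the shift `D` has Frobenius norm `O(n ^ (-1/2))`. Since
`log det (Ω + D)` and `log det Ω` differ by at most about `√p * ‖Ω⁻¹‖ * ‖D‖_F`, and likewise for the
trace term, the prior density at `Ω` is that at `Ω + D` up to a factor `exp (± O(√(p / n)))`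
(`coneWeight_shift_le`). Replacing the one by the other and translating, the numerator of the ratio
becomes the posterior mass of a shifted ball. That ball contains the ball with half the radius,
because `√n * ρ → ∞`, so the ratio is squeezed between quantities tending to one
(`shiftRatio_wishart_bounds`). The rank bound matters only for the rate at which the sets must
shrink.

The radii are `(p / n) ^ (1/4)` for general functionals of the covariance matrix,
`√(p / n) * (n / (r p ^ 2)) ^ (1/4)` for functionals of the precision matrix, and a constant multiple
of `√(p / n)` when `p → ∞`.
-/

/-! ### Quadratic forms and matrix norms -/

theorem posDef_iff_forall_dotProduct {d : ℕ} {A : RMat d} :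
    A.PosDef ↔ A.IsSymm ∧ ∀ x : Fin d → ℝ, x ≠ 0 → 0 < x ⬝ᵥ A.mulVec x := by
  rw [Matrix.posDef_iff_dotProduct_mulVec]
  simp [Matrix.IsHermitian, Matrix.IsSymm, Matrix.conjTranspose_eq_transpose_of_trivial]

theorem Matrix.PosDef.isSymm_real {d : ℕ} {A : RMat d} (hA : A.PosDef) : A.IsSymm :=
  (posDef_iff_forall_dotProduct.1 hA).1

theorem Matrix.PosDef.dotProduct_nonneg {d : ℕ} {A : RMat d} (hA : A.PosDef) (x : Fin d → ℝ) :
    0 ≤ x ⬝ᵥ A.mulVec x := by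
  simpa using hA.posSemidef.dotProduct_mulVec_nonneg x

theorem Matrix.IsSymm.dotProduct_mulVec_comm {d : ℕ} {A : RMat d} (hA : A.IsSymm)
    (u v : Fin d → ℝ) : u ⬝ᵥ A.mulVec v = v ⬝ᵥ A.mulVec u := by
  rw [Matrix.dotProduct_mulVec, ← Matrix.mulVec_transpose, hA, dotProduct_comm]

theorem norm_toLp_sq {d : ℕ} (u : Fin d → ℝ) : ‖WithLp.toLp 2 u‖ ^ 2 = u ⬝ᵥ u := by
  rw [EuclideanSpace.real_norm_sq_eq]
  simp [dotProduct, sq]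

theorem abs_dotProduct_mulVec_le {d : ℕ} (A : RMat d) (u v : Fin d → ℝ) :
    |u ⬝ᵥ A.mulVec v| ≤ ‖A‖ * (‖WithLp.toLp 2 u‖ * ‖WithLp.toLp 2 v‖) := by
  have h := Matrix.inner_toEuclideanCLM A (WithLp.toLp 2 u) (WithLp.toLp 2 v)
  simp only at h
  rw [← h]
  refine (abs_real_inner_le_norm _ _).trans ?_
  have h2 := (Matrix.toEuclideanCLM (𝕜 := ℝ) A).le_opNorm (WithLp.toLp 2 v)
  rw [Matrix.l2_opNorm_toEuclideanCLM] at h2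
  nlinarith [norm_nonneg (WithLp.toLp 2 u)]

theorem abs_quadForm_le {d : ℕ} (A : RMat d) (u : Fin d → ℝ) :
    |u ⬝ᵥ A.mulVec u| ≤ ‖A‖ * (u ⬝ᵥ u) := by
  have h := abs_dotProduct_mulVec_le A u u
  rwa [← sq, norm_toLp_sq] at h

/-- The spectral norm of a symmetric matrix is controlled by its quadratic form. -/
theorem norm_le_of_forall_abs_quadForm_le {d : ℕ} {A : RMat d} (hA : A.IsSymm) {c : ℝ}
    (hc : 0 ≤ c) (h : ∀ u : Fin d → ℝ, |u ⬝ᵥ A.mulVec u| ≤ c * (u ⬝ᵥ u)) : ‖A‖ ≤ c := by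
  -- polarization
  have hpol : ∀ u v : Fin d → ℝ, u ⬝ᵥ A.mulVec v ≤ c / 2 * (u ⬝ᵥ u + v ⬝ᵥ v) := by
    intro u v
    have h1 := (abs_le.1 (h (u + v))).2
    have h2 := (abs_le.1 (h (u - v))).1
    have hs := hA.dotProduct_mulVec_comm v u
    simp only [Matrix.mulVec_add, Matrix.mulVec_sub, dotProduct_add, add_dotProduct,
      sub_dotProduct, dotProduct_sub] at h1 h2
    have hs' := dotProduct_comm v u
    nlinarith
  rw [← Matrix.l2_opNorm_toEuclideanCLM]
  refine ContinuousLinearMap.opNorm_le_bound _ hc fun x => ?_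
  have hx : ‖x‖ ^ 2 = x.ofLp ⬝ᵥ x.ofLp := norm_toLp_sq x.ofLp
  have hAx : ‖Matrix.toEuclideanCLM (𝕜 := ℝ) A x‖ ^ 2 = A.mulVec x.ofLp ⬝ᵥ A.mulVec x.ofLp :=
    norm_toLp_sq (A.mulVec x.ofLp)
  have key : ∀ t : ℝ, t * (A.mulVec x.ofLp ⬝ᵥ A.mulVec x.ofLp)
      ≤ c / 2 * (t ^ 2 * (A.mulVec x.ofLp ⬝ᵥ A.mulVec x.ofLp) + x.ofLp ⬝ᵥ x.ofLp) := by
    intro t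
    have := hpol (t • A.mulVec x.ofLp) x.ofLp
    simp only [smul_dotProduct, dotProduct_smul, smul_eq_mul] at this
    nlinarith
  rw [← hAx, ← hx] at key
  refine abs_le_of_sq_le_sq' ?_ (by positivity) |>.2
  rcases hc.eq_or_lt with rfl | hc
  · have := key 1
    nlinarith
  · have := key (1 / c)
    have h2 := mul_le_mul_of_nonneg_left this (by positivity : 0 ≤ 2 * c)
    field_simp at h2
    nlinarith

/-- A maximal separated subset of a subset of the ball of radius `2` is finite, with a cardinality
that is exponential in the dimension. -/
theorem exists_finset_net (d : ℕ) (K : Set (EuclideanSpace ℝ (Fin d))) (hK : ∀ x ∈ K, ‖x‖ ≤ 2) :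
    ∃ s : Finset (EuclideanSpace ℝ (Fin d)), s.card ≤ 5 ^ d ∧ (∀ x ∈ s, x ∈ K) ∧
      ∀ x ∈ K, ∃ y ∈ s, ‖x - y‖ ≤ 1 := by
  classical
  let P : Finset (EuclideanSpace ℝ (Fin d)) → Prop := fun s =>
    (∀ x ∈ s, x ∈ K) ∧ ∀ c ∈ s, ∀ e ∈ s, c ≠ e → 1 ≤ ‖c - e‖
  have hcard : ∀ s, P s → s.card ≤ 5 ^ d := by
    intro s hs
    simpa using Besicovitch.card_le_of_separated s (fun c hc => hK c (hs.1 c hc)) hs.2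
  obtain ⟨s, hs, hmax⟩ : ∃ s, P s ∧ ∀ t, P t → t.card ≤ s.card := by
    let Q : ℕ → Prop := fun k => ∃ s, P s ∧ s.card = k
    have hQ : Q 0 := ⟨∅, ⟨by simp, by simp⟩, rfl⟩
    obtain ⟨s, hs, hsc⟩ := Nat.findGreatest_spec (P := Q) (Nat.zero_le (5 ^ d)) hQ
    refine ⟨s, hs, fun t ht => ?_⟩
    rw [hsc]
    exact Nat.le_findGreatest (hcard t ht) ⟨t, ht, rfl⟩
  refine ⟨s, hcard s hs, hs.1, fun x hx => ?_⟩
  by_contra! hcon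
  have hxs : x ∉ s := fun hxs => by
    have := hcon x hxs
    simp at this
    linarith
  have hP : P (insert x s) := by
    refine ⟨?_, ?_⟩
    · intro y hy
      rcases Finset.mem_insert.1 hy with rfl | hy
      exacts [hx, hs.1 y hy]
    · intro c hc e he hce
      rcases Finset.mem_insert.1 hc with hcx | hcs <;>
        rcases Finset.mem_insert.1 he with hex | hes
      · exact absurd (hcx.trans hex.symm) hce
      · exact hcx ▸ (hcon e hes).le
      · rw [norm_sub_rev]; exact hex ▸ (hcon c hcs).le
      · exact hs.2 c hcs e hes hce
  have := hmax _ hP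
  rw [Finset.card_insert_of_notMem hxs] at this
  omega

/-- Finitely many unit vectors, at most `5 ^ d` of them, suffice to control the spectral norm of
all symmetric matrices. They form a `1 / 2`-net of the sphere: for unit vectors at distance at most
`1 / 2`, `‖u - x‖ * ‖u + x‖ ≤ √15 / 4 < 31 / 32`, whence the factor `32`. -/
theorem exists_finset_norm_le (d : ℕ) : ∃ s : Finset (Fin d → ℝ), s.card ≤ 5 ^ d ∧
    (∀ x ∈ s, x ⬝ᵥ x = 1) ∧ ∀ A : RMat d, A.IsSymm → ∀ c : ℝ, 0 ≤ c →
      (∀ x ∈ s, |x ⬝ᵥ A.mulVec x| ≤ c) → ‖A‖ ≤ 32 * c := by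
  classical
  obtain ⟨s, hcard, hsK, hnet⟩ := exists_finset_net d {x | ‖x‖ = 2} (fun x hx => le_of_eq hx)
  refine ⟨s.image fun x => (1 / 2 : ℝ) • x.ofLp, Finset.card_image_le.trans hcard, ?_, ?_⟩
  · intro x hx
    obtain ⟨y, hy, rfl⟩ := Finset.mem_image.1 hx
    have h1 : ‖y‖ ^ 2 = y.ofLp ⬝ᵥ y.ofLp := norm_toLp_sq y.ofLp
    have h2 : ‖y‖ = 2 := hsK y hy
    rw [smul_dotProduct, dotProduct_smul, ← h1, h2]
    norm_num
  · intro A hA c hc h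
    have main : ‖A‖ ≤ c + 31 / 32 * ‖A‖ := by
      refine norm_le_of_forall_abs_quadForm_le hA (by positivity) fun u => ?_
      by_cases hu : u = 0
      · simp [hu]
      set r : ℝ := ‖WithLp.toLp 2 u‖ with hr
      have hr0 : 0 < r := by
        rw [hr, norm_pos_iff]
        simpa using hu
      have hru : r ^ 2 = u ⬝ᵥ u := norm_toLp_sq u
      set w : EuclideanSpace ℝ (Fin d) := (2 / r) • WithLp.toLp 2 u with hw
      have hwn : ‖w‖ = 2 := by
        rw [hw, norm_smul, Real.norm_of_nonneg (by positivity), ← hr]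
        field_simp
      obtain ⟨y, hy, hwy⟩ := hnet w hwn
      have hyn : ‖y‖ = 2 := hsK y hy
      have hpar := parallelogram_law_with_norm ℝ w y
      have hAy := h _ (Finset.mem_image_of_mem _ hy)
      have hprod : ‖w - y‖ * ‖w + y‖ ≤ 31 / 8 := by
        have hp0 := norm_nonneg (w + y)
        have hm0 := norm_nonneg (w - y)
        rw [hwn, hyn] at hpar
        refine abs_le_of_sq_le_sq' ?_ (by norm_num) |>.2
        have : ‖w - y‖ ^ 2 ≤ 1 := by nlinarith
        rw [mul_pow]
        nlinarith [mul_nonneg (sq_nonneg ‖w - y‖) (sub_nonneg.2 this)]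
      have hcross := abs_dotProduct_mulVec_le A (w - y).ofLp (w + y).ofLp
      have e1 : ‖WithLp.toLp 2 (w - y).ofLp‖ = ‖w - y‖ := rfl
      have e2 : ‖WithLp.toLp 2 (w + y).ofLp‖ = ‖w + y‖ := rfl
      rw [e1, e2] at hcross
      have hexp : (w - y).ofLp ⬝ᵥ A.mulVec (w + y).ofLp
          = w.ofLp ⬝ᵥ A.mulVec w.ofLp - y.ofLp ⬝ᵥ A.mulVec y.ofLp := by
        have hs := hA.dotProduct_mulVec_comm w.ofLp y.ofLp
        simp only [WithLp.ofLp_add, WithLp.ofLp_sub, Matrix.mulVec_add, dotProduct_add,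
          sub_dotProduct]
        linarith
      have hww : w.ofLp ⬝ᵥ A.mulVec w.ofLp = 4 / r ^ 2 * (u ⬝ᵥ A.mulVec u) := by
        simp only [hw, WithLp.ofLp_smul, Matrix.mulVec_smul, smul_dotProduct, dotProduct_smul,
          smul_eq_mul]
        ring
      rw [Matrix.mulVec_smul, smul_dotProduct, dotProduct_smul, smul_eq_mul, smul_eq_mul, abs_mul,
        abs_mul] at hAy
      norm_num at hAy
      have hA0 := norm_nonneg A
      have htri : |w.ofLp ⬝ᵥ A.mulVec w.ofLp| ≤ 4 * c + ‖A‖ * (31 / 8) := by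
        have : w.ofLp ⬝ᵥ A.mulVec w.ofLp = (w - y).ofLp ⬝ᵥ A.mulVec (w + y).ofLp
          + y.ofLp ⬝ᵥ A.mulVec y.ofLp := by rw [hexp]; ring
        rw [this]
        refine (abs_add_le _ _).trans ?_
        have := mul_le_mul_of_nonneg_left hprod hA0
        linarith
      rw [hww, abs_mul, abs_of_pos (by positivity : 0 < 4 / r ^ 2)] at htri
      rw [← hru]
      have := mul_le_mul_of_nonneg_left htri (by positivity : 0 ≤ r ^ 2 / 4)
      have e : r ^ 2 / 4 * (4 / r ^ 2 * |u ⬝ᵥ A.mulVec u|) = |u ⬝ᵥ A.mulVec u| := by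
        field_simp
      rw [e] at this
      nlinarith
    linarith

/-- Inversion reverses the Loewner order, in terms of quadratic forms. -/
theorem quadForm_inv_anti {d : ℕ} {Q R : RMat d} (hQ : Q.PosDef) (hR : R.PosDef)
    (h : ∀ w : Fin d → ℝ, w ⬝ᵥ Q.mulVec w ≤ w ⬝ᵥ R.mulVec w) (u : Fin d → ℝ) :
    u ⬝ᵥ R⁻¹.mulVec u ≤ u ⬝ᵥ Q⁻¹.mulVec u := by
  set w := R⁻¹.mulVec u
  have hRw : R.mulVec w = u := by
    simp [w, Matrix.mulVec_mulVec, Matrix.mul_nonsing_inv R ((Matrix.isUnit_iff_isUnit_det _).1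
      hR.isUnit)]
  have hQu : Q.mulVec (Q⁻¹.mulVec u) = u := by
    simp [Matrix.mulVec_mulVec, Matrix.mul_nonsing_inv Q ((Matrix.isUnit_iff_isUnit_det _).1
      hQ.isUnit)]
  have h0 := hQ.dotProduct_nonneg (w - Q⁻¹.mulVec u)
  have hw := h w
  have hs := hQ.isSymm_real.dotProduct_mulVec_comm (Q⁻¹.mulVec u) w
  simp only [Matrix.mulVec_sub, dotProduct_sub, sub_dotProduct, hQu, hRw] at h0 hw hs
  rw [dotProduct_comm (Q⁻¹.mulVec u) u] at h0
  rw [dotProduct_comm w u] at h0 hw hs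
  linarith

/-! ### The Frobenius norm and the log-determinant -/

theorem frobNorm_nonneg {d : ℕ} (A : RMat d) : 0 ≤ frobNorm A := Real.sqrt_nonneg _

theorem frobNorm_sq {d : ℕ} (A : RMat d) : frobNorm A ^ 2 = ∑ i, ∑ j, A i j ^ 2 :=
  Real.sq_sqrt (by positivity)

theorem frobNorm_transpose {d : ℕ} (A : RMat d) : frobNorm A.transpose = frobNorm A := by
  unfold frobNorm
  rw [Finset.sum_comm]
  rfl

theorem frobNorm_smul {d : ℕ} (c : ℝ) (A : RMat d) : frobNorm (c • A) = |c| * frobNorm A := by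
  unfold frobNorm
  simp only [Matrix.smul_apply, smul_eq_mul, mul_pow, ← Finset.mul_sum]
  rw [Real.sqrt_mul (sq_nonneg c), Real.sqrt_sq_eq_abs]

theorem frobNorm_one (d : ℕ) : frobNorm (1 : RMat d) = Real.sqrt d := by
  unfold frobNorm
  simp [Matrix.one_apply]

theorem frobNorm_mul_le {d : ℕ} (A B : RMat d) : frobNorm (A * B) ≤ ‖A‖ * frobNorm B := by
  refine abs_le_of_sq_le_sq' ?_ (mul_nonneg (norm_nonneg _) (frobNorm_nonneg _)) |>.2
  rw [mul_pow, frobNorm_sq, frobNorm_sq, Finset.sum_comm, Finset.sum_comm (f := fun i j => B i j ^ 2),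
    Finset.mul_sum]
  refine Finset.sum_le_sum fun j _ => ?_
  have h := A.l2_opNorm_mulVec (WithLp.toLp 2 fun i => B i j)
  have h1 : ∑ i, (A * B) i j ^ 2
      = ‖(EuclideanSpace.equiv (Fin d) ℝ).symm (A.mulVec fun i => B i j)‖ ^ 2 := by
    rw [EuclideanSpace.real_norm_sq_eq]
    rfl
  have h2 : ∑ i, B i j ^ 2 = ‖(WithLp.toLp 2 fun i => B i j : EuclideanSpace ℝ (Fin d))‖ ^ 2 := by
    rw [EuclideanSpace.real_norm_sq_eq]
  rw [h1, h2, ← mul_pow]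
  exact pow_le_pow_left₀ (norm_nonneg _) h 2

theorem norm_transpose {d : ℕ} (A : RMat d) : ‖A.transpose‖ = ‖A‖ := by
  rw [← Matrix.conjTranspose_eq_transpose_of_trivial, Matrix.l2_opNorm_conjTranspose]

theorem frobNorm_mul_le' {d : ℕ} (A B : RMat d) : frobNorm (A * B) ≤ frobNorm A * ‖B‖ := by
  rw [← frobNorm_transpose, Matrix.transpose_mul, ← frobNorm_transpose A, ← norm_transpose B,
    mul_comm]
  exact frobNorm_mul_le _ _

theorem frobNorm_le_sqrt_mul_norm {d : ℕ} (A : RMat d) : frobNorm A ≤ Real.sqrt d * ‖A‖ := by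
  have := frobNorm_mul_le A 1
  rwa [mul_one, frobNorm_one, mul_comm] at this

theorem norm_le_frobNorm {d : ℕ} (A : RMat d) : ‖A‖ ≤ frobNorm A := by
  rw [← Matrix.l2_opNorm_toEuclideanCLM]
  refine ContinuousLinearMap.opNorm_le_bound _ (frobNorm_nonneg _) fun x => ?_
  refine abs_le_of_sq_le_sq' ?_ (mul_nonneg (frobNorm_nonneg _) (norm_nonneg _)) |>.2
  rw [mul_pow, frobNorm_sq, EuclideanSpace.real_norm_sq_eq, EuclideanSpace.real_norm_sq_eq,
    Finset.sum_mul]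
  refine Finset.sum_le_sum fun i _ => ?_
  simp only [Matrix.ofLp_toEuclideanCLM, Matrix.mulVec, dotProduct]
  exact Finset.sum_mul_sq_le_sq_mul_sq _ _ _

theorem abs_trace_mul_le {d : ℕ} (A B : RMat d) : |(A * B).trace| ≤ frobNorm A * frobNorm B := by
  refine abs_le_of_sq_le_sq ?_ (mul_nonneg (frobNorm_nonneg _) (frobNorm_nonneg _))
  rw [mul_pow, ← frobNorm_transpose B, frobNorm_sq, frobNorm_sq]
  simp only [Matrix.trace, Matrix.diag, Matrix.mul_apply, ← Finset.sum_product',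
    Matrix.transpose_apply]
  exact Finset.sum_mul_sq_le_sq_mul_sq _ _ _

theorem Matrix.PosDef.log_det_le_trace_sub {d : ℕ} {A : RMat d} (hA : A.PosDef) :
    Real.log A.det ≤ A.trace - d := by
  have h1 : A.det = ∏ i, hA.1.eigenvalues i := by
    simpa using hA.1.det_eq_prod_eigenvalues
  have h2 : A.trace = ∑ i, hA.1.eigenvalues i := by
    simpa using hA.1.trace_eq_sum_eigenvalues
  rw [h1, h2, Real.log_prod (fun i _ => (hA.eigenvalues_pos i).ne')]
  calc ∑ i, Real.log (hA.1.eigenvalues i) ≤ ∑ i, (hA.1.eigenvalues i - 1) :=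
        Finset.sum_le_sum fun i _ => Real.log_le_sub_one_of_pos (hA.eigenvalues_pos i)
    _ = _ := by simp

theorem Matrix.PosDef.sqrt_mul_self {d : ℕ} {A : RMat d} (hA : A.PosDef) :
    CFC.sqrt A * CFC.sqrt A = A :=
  CFC.sqrt_mul_sqrt_self A hA.posSemidef.nonneg

theorem Matrix.PosDef.sqrt {d : ℕ} {A : RMat d} (hA : A.PosDef) : (CFC.sqrt A).PosDef := by
  have h0 : (CFC.sqrt A).PosSemidef :=
    Matrix.nonneg_iff_posSemidef.1 (CFC.sqrt_nonneg A)
  rw [h0.posDef_iff_det_ne_zero]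
  intro h
  have := congrArg Matrix.det hA.sqrt_mul_self
  rw [Matrix.det_mul, h, zero_mul] at this
  exact hA.det_pos.ne this

theorem Matrix.PosDef.isUnit_det_real {d : ℕ} {A : RMat d} (hA : A.PosDef) : IsUnit A.det :=
  (Matrix.isUnit_iff_isUnit_det _).1 hA.isUnit

theorem Matrix.PosDef.norm_sqrt_mul_self {d : ℕ} {A : RMat d} (hA : A.PosDef) :
    ‖CFC.sqrt A‖ * ‖CFC.sqrt A‖ = ‖A‖ := by
  have h := Matrix.l2_opNorm_conjTranspose_mul_self (CFC.sqrt A)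
  rw [hA.sqrt.1, hA.sqrt_mul_self] at h
  exact h.symm

/-- Concavity of the log-determinant, as a tangent bound. -/
theorem log_det_add_sub_le {d : ℕ} {A D : RMat d} (hA : A.PosDef) (hAD : (A + D).PosDef) :
    Real.log (A + D).det - Real.log A.det ≤ Real.sqrt d * ‖A⁻¹‖ * frobNorm D := by
  set R := CFC.sqrt A⁻¹ with hR
  have hRp : R.PosDef := hA.inv.sqrt
  have hRR : R * R = A⁻¹ := hA.inv.sqrt_mul_self
  have hRs : R.transpose = R := hRp.isSymm_real
  have hB : (R * (A + D) * R).PosDef := by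
    have h : Function.Injective R.mulVec :=
      Matrix.mulVec_injective_iff_isUnit.2 hRp.isUnit
    have := hAD.conjTranspose_mul_mul_same h
    rwa [Matrix.conjTranspose_eq_transpose_of_trivial, hRs] at this
  have hdet : (R * (A + D) * R).det = (A + D).det / A.det := by
    have : (R * R).det = A.det⁻¹ := by rw [hRR, Matrix.det_nonsing_inv, Ring.inverse_eq_inv']
    rw [Matrix.det_mul, Matrix.det_mul, div_eq_mul_inv, ← this, Matrix.det_mul]
    ring
  have htr : (R * (A + D) * R).trace = d + (A⁻¹ * D).trace := by
    rw [Matrix.trace_mul_comm, ← mul_assoc, hRR, mul_add, Matrix.trace_add,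
      Matrix.nonsing_inv_mul _ hA.isUnit_det_real]
    simp
  have h := hB.log_det_le_trace_sub
  rw [hdet, htr, Real.log_div hAD.det_pos.ne' hA.det_pos.ne'] at h
  have h2 := (le_abs_self _).trans (abs_trace_mul_le A⁻¹ D)
  have h3 := mul_le_mul_of_nonneg_right (frobNorm_le_sqrt_mul_norm A⁻¹) (frobNorm_nonneg D)
  linarith

/-! ### Measurability on matrices -/

instance instBorelSpaceRMat (d : ℕ) : BorelSpace (RMat d) :=
  inferInstanceAs (BorelSpace (Fin d → Fin d → ℝ))

theorem measurableSet_posDef (d : ℕ) : MeasurableSet {A : RMat d | A.PosDef} := by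
  have h : {A : RMat d | A.PosDef} = ({A | A.IsSymm} ∩
      ⋂ x : Fin d → ℝ, {A | 0 ≤ x ⬝ᵥ A.mulVec x}) ∩ {A | A.det ≠ 0} := by
    ext A
    simp only [Set.mem_inter_iff, Set.mem_iInter, Set.mem_ofPred_eq]
    constructor
    · exact fun hA => ⟨⟨hA.isSymm_real, hA.dotProduct_nonneg⟩, hA.det_pos.ne'⟩
    · rintro ⟨⟨hs, hn⟩, hd⟩
      refine (Matrix.PosSemidef.posDef_iff_det_ne_zero ?_).2 hd
      refine Matrix.PosSemidef.of_dotProduct_mulVec_nonneg ?_ (fun x => by simpa using hn x)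
      rwa [Matrix.IsHermitian, Matrix.conjTranspose_eq_transpose_of_trivial]
  rw [h]
  have hdet : Continuous fun A : RMat d => A.det := Continuous.matrix_det continuous_id
  refine MeasurableSet.inter (IsClosed.measurableSet (IsClosed.inter ?_ ?_))
    (isOpen_ne_fun hdet continuous_const).measurableSet
  · exact isClosed_eq (Continuous.matrix_transpose continuous_id) continuous_id
  · refine isClosed_iInter fun x => isClosed_le continuous_const ?_
    exact Continuous.dotProduct continuous_const (Continuous.matrix_mulVec continuous_id
      continuous_const)

theorem measurable_det (d : ℕ) : Measurable fun A : RMat d => A.det :=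
  (Continuous.matrix_det continuous_id).measurable

theorem measurable_trace_mul {d : ℕ} (G : RMat d) : Measurable fun A : RMat d => (A * G).trace :=
  (Continuous.matrix_trace (continuous_id.matrix_mul continuous_const)).measurable

/-! ### The Wishart weights and their total mass -/

/-- The density `det Ω ^ a * exp (- tr (Ω G) / 2)` on the positive definite cone, extended
by zero. -/
noncomputable def coneWeight {d : ℕ} (a : ℝ) (G : RMat d) : RMat d → ENNReal :=
  Set.indicator {Ω | Ω.PosDef} fun Ω =>
    ENNReal.ofReal (Real.exp (a * Real.log Ω.det - 1 / 2 * (Ω * G).trace))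

theorem measurable_coneWeight {d : ℕ} (a : ℝ) (G : RMat d) : Measurable (coneWeight a G) := by
  refine Measurable.indicator ?_ (measurableSet_posDef d)
  have h1 := (measurable_det d).log.const_mul a
  have h2 := (measurable_trace_mul G).const_mul (1 / 2)
  exact (Real.measurable_exp.comp (h1.sub h2)).ennreal_ofReal

/-- The total mass of `coneWeight a G` for Lebesgue measure on symmetric matrices. -/
noncomputable def coneMass {d : ℕ} (a : ℝ) (G : RMat d) : ENNReal :=
  ∫⁻ Ω, coneWeight a G Ω ∂symLebesgue d

theorem Matrix.PosDef.abs_apply_le {d : ℕ} {A : RMat d} (hA : A.PosDef) (i j : Fin d) :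
    |A i j| ≤ A.trace := by
  have hdiag : ∀ k, 0 ≤ A k k := fun k => hA.posSemidef.diag_nonneg
  have hle : ∀ k, A k k ≤ A.trace := fun k =>
    Finset.single_le_sum (f := fun k => A k k) (fun k _ => hdiag k) (Finset.mem_univ k)
  have hij : A j i = A i j := hA.isSymm_real.apply i j
  have h1 := hA.dotProduct_nonneg (Pi.single i 1 + Pi.single j 1)
  have h2 := hA.dotProduct_nonneg (Pi.single i 1 - Pi.single j 1)
  simp [Matrix.mulVec_add, Matrix.mulVec_sub, hij] at h1 h2
  have hi := hle i
  have hj := hle j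
  rw [abs_le]
  constructor <;> linarith

theorem lintegral_inv_sqrt_mul_exp_lt_top {κ : ℝ} (hκ : 0 < κ) :
    ∫⁻ x : ℝ, (Set.Ioi 0).indicator (fun x => ENNReal.ofReal (Real.exp (-(1 / 2) * Real.log x
      - κ * x))) x < ⊤ := by
  rw [lintegral_indicator measurableSet_Ioi]
  have h := integrableOn_rpow_mul_exp_neg_mul_rpow (s := -(1 / 2)) (p := 1) (b := κ)
    (by norm_num) one_pos hκ
  refine lt_of_le_of_lt (le_of_eq (setLIntegral_congr_fun measurableSet_Ioi fun x hx => ?_))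
    h.lintegral_lt_top
  rw [Real.rpow_def_of_pos hx, ← Real.exp_add, Real.rpow_one]
  congr 2
  ring

/-- The symmetric matrix with diagonal `x` and off-diagonal entries from `O`. -/
def withDiag {d : ℕ} (O : RMat d) (x : Fin d → ℝ) : RMat d :=
  Matrix.of fun i j => if i = j then x i else O i j

theorem measurable_withDiag {d : ℕ} :
    Measurable fun y : RMat d × (Fin d → ℝ) => withDiag y.1 y.2 := by
  refine measurable_pi_lambda _ fun i => measurable_pi_lambda _ fun j => ?_
  by_cases h : i = j
  · subst h
    simpa [withDiag] using! (measurable_pi_apply i).comp measurable_snd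
  · have : Measurable fun A : RMat d => A i j :=
      (measurable_pi_apply j).comp (measurable_pi_apply i)
    simpa [withDiag, h] using! this.comp measurable_fst

theorem withDiag_submatrix_succ {d : ℕ} (O : RMat (d + 1)) (t : ℝ) (x : Fin d → ℝ) :
    (withDiag O (Fin.cons t x)).submatrix Fin.succ Fin.succ
      = withDiag (O.submatrix Fin.succ Fin.succ) x := by
  ext i j
  simp [withDiag, Fin.succ_inj]

/-- The determinant is affine in the first diagonal entry. -/
theorem det_withDiag_cons {d : ℕ} (O : RMat (d + 1)) (t : ℝ) (x : Fin d → ℝ) :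
    (withDiag O (Fin.cons t x)).det = t * (withDiag (O.submatrix Fin.succ Fin.succ) x).det
      + (withDiag O (Fin.cons 0 x)).det := by
  rw [Matrix.det_succ_row_zero, Matrix.det_succ_row_zero (withDiag O (Fin.cons 0 x)),
    Fin.sum_univ_succ, Fin.sum_univ_succ]
  have hs : ∀ (s : ℝ) (j : Fin d), (withDiag O (Fin.cons s x)).submatrix Fin.succ
      (Fin.succAbove j.succ) = (withDiag O (Fin.cons 0 x)).submatrix Fin.succ
      (Fin.succAbove j.succ) := by
    intro s j
    ext i k
    simp only [Matrix.submatrix_apply, withDiag, Matrix.of_apply, Fin.cons_succ]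
  have h0 : ∀ (s : ℝ) (j : Fin d), withDiag O (Fin.cons s x) 0 j.succ = O 0 j.succ := by
    intro s j
    simp [withDiag, (Fin.succ_ne_zero j).symm]
  have h00 : ∀ s : ℝ, withDiag O (Fin.cons s x) 0 0 = s := by
    intro s
    simp [withDiag]
  simp only [hs t, h0, h00, Fin.succAbove_zero, withDiag_submatrix_succ]
  simp

/-- Integrability of `det ^ (-1/2)` over the diagonal, uniformly in the off-diagonal entries:
integrate out one diagonal entry at a time. The determinant is `det A * (t - t₀)` as a function of
the first diagonal entry `t`, where `A` is the complementary minor, so that integrating over `t`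
leaves `det A ^ (-1/2)`. -/
theorem lintegral_withDiag_le {κ : ℝ} {C : ENNReal}
    (hC : ∫⁻ x : ℝ, (Set.Ioi 0).indicator (fun x => ENNReal.ofReal (Real.exp (-(1 / 2) *
      Real.log x - κ * x))) x = C) (hκ : 0 < κ) (d : ℕ) (O : RMat d) :
    ∫⁻ x : Fin d → ℝ, coneWeight (-(1 / 2)) ((2 * κ) • (1 : RMat d)) (withDiag O x) ≤ C ^ d := by
  have hval : ∀ {d : ℕ} {M : RMat d}, M.PosDef →
      coneWeight (-(1 / 2)) ((2 * κ) • (1 : RMat d)) M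
        = ENNReal.ofReal (Real.exp (-(1 / 2) * Real.log M.det - κ * M.trace)) := by
    intro d M hM
    rw [coneWeight, Set.indicator_of_mem (by exact hM)]
    simp only [Matrix.mul_smul, mul_one, Matrix.trace_smul, smul_eq_mul]
    congr 3
    ring
  induction d with
  | zero =>
    have h1 : withDiag O (default : Fin 0 → ℝ) = 1 := Subsingleton.elim _ _
    have : ∀ x : Fin 0 → ℝ, coneWeight (-(1 / 2)) ((2 * κ) • (1 : RMat 0)) (withDiag O x) = 1 := by
      intro x
      rw [Subsingleton.elim (withDiag O x) 1, hval Matrix.PosDef.one]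
      simp
    simp only [this, pow_zero]
    simp [volume_pi]
  | succ d ih =>
    set f : ℝ → ENNReal := (Set.Ioi 0).indicator (fun x => ENNReal.ofReal (Real.exp (-(1 / 2) *
      Real.log x - κ * x))) with hf
    set O' : RMat d := O.submatrix Fin.succ Fin.succ
    have hmeas : Measurable fun x : Fin (d + 1) → ℝ =>
        coneWeight (-(1 / 2)) ((2 * κ) • (1 : RMat (d + 1))) (withDiag O x) :=
      (measurable_coneWeight _ _).comp (measurable_withDiag.comp measurable_prodMk_left)
    have hmp := volume_preserving_piFinSuccAbove (fun _ : Fin (d + 1) => ℝ) 0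
    have hsymm := hmp.symm
    rw [← hsymm.lintegral_comp hmeas, Measure.volume_eq_prod,
      lintegral_prod_symm (fun y => coneWeight (-(1 / 2)) ((2 * κ) • (1 : RMat (d + 1)))
        (withDiag O ((MeasurableEquiv.piFinSuccAbove (fun _ => ℝ) 0).symm y)))
        (hmeas.comp hsymm.measurable).aemeasurable]
    have hinner : ∀ x : Fin d → ℝ, ∫⁻ t : ℝ, coneWeight (-(1 / 2)) ((2 * κ) • (1 : RMat (d + 1)))
        (withDiag O ((MeasurableEquiv.piFinSuccAbove (fun _ : Fin (d + 1) => ℝ) 0).symm (t, x)))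
        ≤ C * coneWeight (-(1 / 2)) ((2 * κ) • (1 : RMat d)) (withDiag O' x) := by
      intro x
      set e := (withDiag O (Fin.cons 0 x)).det
      set m := (withDiag O' x).det with hm
      set y := max (-e / m) 0 with hy
      rw [← hC, ← lintegral_sub_right_eq_self f y, ← lintegral_mul_const']
      · refine lintegral_mono fun t => ?_
        change coneWeight (-(1 / 2)) ((2 * κ) • (1 : RMat (d + 1))) (withDiag O
          (Fin.insertNth 0 t x)) ≤ _
        rw [Fin.insertNth_zero']
        by_cases hM : (withDiag O (Fin.cons t x)).PosDef
        · have hM' : (withDiag O' x).PosDef := by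
            have := hM.submatrix (e := Fin.succ) (Fin.succ_injective d)
            rwa [withDiag_submatrix_succ] at this
          have hmpos : 0 < m := hM'.det_pos
          have hdet : (withDiag O (Fin.cons t x)).det = m * (t - -e / m) := by
            rw [det_withDiag_cons]
            field_simp
            ring
          have hpos : 0 < t - -e / m := by
            have := hM.det_pos
            rw [hdet] at this
            exact pos_of_mul_pos_right this hmpos.le
          have ht0 : 0 < t := by
            have := hM.diag_pos (i := 0)
            simpa [withDiag] using this
          have hty : 0 < t - y := by
            rcases le_total (-e / m) 0 with h | h
            · rw [hy, max_eq_right h]; linarith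
            · rw [hy, max_eq_left h]; exact hpos
          have htr : (withDiag O (Fin.cons t x)).trace = t + (withDiag O' x).trace := by
            simp [Matrix.trace, withDiag, Fin.sum_univ_succ]
          rw [hval hM, hval hM', hf, Set.indicator_of_mem (by exact hty),
            ← ENNReal.ofReal_mul (Real.exp_nonneg _), ← Real.exp_add, hdet, htr,
            Real.log_mul hmpos.ne' hpos.ne']
          refine ENNReal.ofReal_le_ofReal (Real.exp_le_exp.2 ?_)
          have h1 : Real.log (t - y) ≤ Real.log (t - -e / m) := by
            refine Real.log_le_log hty ?_
            have := le_max_left (-e / m) 0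
            rw [← hy] at this
            linarith
          have h2 : 0 ≤ κ * y := mul_nonneg hκ.le (le_max_right _ _)
          nlinarith
        · rw [coneWeight, Set.indicator_of_notMem (by exact hM)]
          exact zero_le
      · by_cases hM' : (withDiag O' x).PosDef
        · rw [hval hM']; exact ENNReal.ofReal_ne_top
        · rw [coneWeight, Set.indicator_of_notMem (by exact hM')]
          exact ENNReal.zero_ne_top
    refine (lintegral_mono hinner).trans ?_
    rw [lintegral_const_mul C (f := fun x => coneWeight (-(1 / 2)) ((2 * κ) • (1 : RMat d))
      (withDiag O' x)) ((measurable_coneWeight _ _).comp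
      (measurable_withDiag.comp measurable_prodMk_left)), pow_succ, mul_comm]
    exact mul_le_mul_left (ih O') C

theorem integrable_exp_neg_mul_abs {c : ℝ} (hc : 0 < c) :
    Integrable fun x : ℝ => Real.exp (-c * |x|) := by
  rw [← integrableOn_univ, ← Set.Iic_union_Ioi (a := (0 : ℝ)), integrableOn_union]
  constructor
  · refine (integrableOn_exp_mul_Iic hc 0).congr_fun (fun x hx => ?_) measurableSet_Iic
    simp only [Set.mem_Iic] at hx
    simp only [abs_of_nonpos hx]
    ring_nf
  · refine (exp_neg_integrableOn_Ioi 0 hc).congr_fun (fun x hx => ?_) measurableSet_Ioi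
    simp only [Set.mem_Ioi] at hx
    simp only [abs_of_pos hx]

theorem lintegral_coneWeight_neg_half_lt_top (d : ℕ) {κ : ℝ} (hκ : 0 < κ) :
    ∫⁻ Ω, coneWeight (-(1 / 2)) ((4 * κ) • (1 : RMat d)) Ω ∂symLebesgue d < ⊤ := by
  classical
  rw [symLebesgue, lintegral_map (measurable_coneWeight _ _) measurable_symMatrix]
  set m : ℝ := Fintype.card {z : Sym2 (Fin d) // ¬ z.IsDiag} + 1
  have hm : 0 < m := by positivity
  set O : ({z : Sym2 (Fin d) // ¬ z.IsDiag} → ℝ) → RMat d := fun y =>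
    Matrix.of fun i j => if h : ¬ (s(i, j)).IsDiag then y ⟨s(i, j), h⟩ else 0
  have hO : Measurable O := by
    refine measurable_pi_lambda _ fun i => measurable_pi_lambda _ fun j => ?_
    by_cases h : i = j
    · subst h
      simp [O]
    · have hd : ¬ (s(i, j)).IsDiag := h
      simp only [O, Matrix.of_apply, hd, not_false_eq_true, dite_true]
      exact measurable_pi_apply _
  set g : ({z : Sym2 (Fin d) // z.IsDiag} → ℝ) × ({z : Sym2 (Fin d) // ¬ z.IsDiag} → ℝ) →
      ENNReal := fun y => coneWeight (-(1 / 2)) ((4 * κ) • (1 : RMat d))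
        (withDiag (O y.2) fun i => y.1 ⟨s(i, i), rfl⟩)
  set k : ({z : Sym2 (Fin d) // z.IsDiag} → ℝ) × ({z : Sym2 (Fin d) // ¬ z.IsDiag} → ℝ) →
      ENNReal := fun y => coneWeight (-(1 / 2)) ((2 * κ) • (1 : RMat d))
        (withDiag (O y.2) fun i => y.1 ⟨s(i, i), rfl⟩)
  have hdiagm : Measurable fun y : {z : Sym2 (Fin d) // z.IsDiag} → ℝ =>
      (fun i => y ⟨s(i, i), rfl⟩ : Fin d → ℝ) :=
    measurable_pi_lambda _ fun i => measurable_pi_apply _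
  have harg : Measurable fun y : ({z : Sym2 (Fin d) // z.IsDiag} → ℝ) ×
      ({z : Sym2 (Fin d) // ¬ z.IsDiag} → ℝ) =>
        withDiag (O y.2) fun i => y.1 ⟨s(i, i), rfl⟩ :=
    measurable_withDiag.comp ((hO.comp measurable_snd).prodMk (hdiagm.comp measurable_fst))
  have hk : Measurable k := (measurable_coneWeight _ _).comp harg
  set E : ({z : Sym2 (Fin d) // ¬ z.IsDiag} → ℝ) → ENNReal := fun y =>
    ENNReal.ofReal (∏ z, Real.exp (-(κ / m) * |y z|))
  have hE : Measurable E := by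
    refine Measurable.ennreal_ofReal ?_
    fun_prop
  -- the off-diagonal entries are bounded by the trace, which provides decay in them
  have hgk : ∀ y, g y ≤ E y.2 * k y := by
    intro y
    by_cases hM : (withDiag (O y.2) fun i => y.1 ⟨s(i, i), rfl⟩).PosDef
    · simp only [g, k, coneWeight]
      rw [Set.indicator_of_mem (by exact hM), Set.indicator_of_mem (by exact hM),
        ← ENNReal.ofReal_mul (Finset.prod_nonneg fun _ _ => Real.exp_nonneg _), ← Real.exp_sum,
        ← Real.exp_add]
      refine ENNReal.ofReal_le_ofReal (Real.exp_le_exp.2 ?_)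
      simp only [Matrix.mul_smul, mul_one, Matrix.trace_smul, smul_eq_mul]
      set T := (withDiag (O y.2) fun i => y.1 ⟨s(i, i), rfl⟩).trace
      have hT : 0 ≤ T := hM.posSemidef.trace_nonneg
      have hz : ∀ z : {z : Sym2 (Fin d) // ¬ z.IsDiag}, |y.2 z| ≤ T := by
        rintro ⟨z, hz⟩
        induction z using Sym2.ind with
        | _ i j =>
          have hij : i ≠ j := hz
          have h1 := hM.abs_apply_le i j
          have h2 : (withDiag (O y.2) fun i => y.1 ⟨s(i, i), rfl⟩) i j = y.2 ⟨s(i, j), hz⟩ := by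
            simp [withDiag, O, hij]
          rwa [h2] at h1
      have hsum : ∑ z, -(κ / m) * |y.2 z| ≥ -(κ * T) := by
        rw [← Finset.mul_sum]
        have h1 : ∑ z, |y.2 z| ≤ m * T := by
          refine (Finset.sum_le_sum fun z _ => hz z).trans ?_
          simp only [Finset.sum_const, Finset.card_univ, nsmul_eq_mul, m]
          nlinarith
        have h2 := mul_le_mul_of_nonneg_left h1 (by positivity : 0 ≤ κ / m)
        have h3 : κ / m * (m * T) = κ * T := by field_simp
        linarith
      linarith
    · simp only [g, coneWeight]
      rw [Set.indicator_of_notMem (by exact hM)]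
      exact zero_le
  set e := MeasurableEquiv.piEquivPiSubtypeProd (fun _ : Sym2 (Fin d) => ℝ) Sym2.IsDiag
  have hmp : MeasurePreserving e :=
    volume_preserving_piEquivPiSubtypeProd (fun _ : Sym2 (Fin d) => ℝ) Sym2.IsDiag
  have hsplit : ∀ x : Sym2 (Fin d) → ℝ,
      coneWeight (-(1 / 2)) ((4 * κ) • (1 : RMat d)) (symMatrix x) = g (e x) := by
    intro x
    simp only [g]
    congr 1
    ext i j
    by_cases h : i = j
    · subst h
      simp only [symMatrix, withDiag, Matrix.of_apply, if_true]
      rfl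
    · have hd : ¬ (s(i, j)).IsDiag := h
      simp only [symMatrix, withDiag, Matrix.of_apply, if_neg h, O, hd, not_false_eq_true,
        dite_true]
      rfl
  simp only [hsplit]
  rw [hmp.lintegral_comp_emb e.measurableEmbedding]
  refine (lintegral_mono hgk).trans_lt ?_
  rw [Measure.volume_eq_prod, lintegral_prod_symm (fun y => E y.2 * k y)
    ((hE.comp measurable_snd).mul hk).aemeasurable]
  obtain ⟨C, hC⟩ : ∃ C, ∫⁻ x : ℝ, (Set.Ioi 0).indicator (fun x => ENNReal.ofReal
    (Real.exp (-(1 / 2) * Real.log x - κ * x))) x = C := ⟨_, rfl⟩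
  have hCtop : C < ⊤ := hC ▸ lintegral_inv_sqrt_mul_exp_lt_top hκ
  have hin : ∀ y2, ∫⁻ y1, E y2 * k (y1, y2) ≤ E y2 * C ^ d := by
    intro y2
    rw [lintegral_const_mul _ (f := fun y1 => k (y1, y2)) (hk.comp measurable_prodMk_right)]
    refine mul_le_mul_right ?_ _
    have hre : MeasurePreserving (MeasurableEquiv.piCongrLeft (fun _ : Fin d => ℝ)
      (Sym2.diagElemEquiv (α := Fin d))) := volume_measurePreserving_piCongrLeft _ _
    refine le_trans (le_of_eq ?_) (lintegral_withDiag_le hC hκ d (O y2))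
    rw [← hre.lintegral_comp_emb (MeasurableEquiv.measurableEmbedding _)]
    refine lintegral_congr fun y1 => ?_
    simp only [k]
    congr 2
  refine (lintegral_mono hin).trans_lt ?_
  rw [lintegral_mul_const _ hE]
  refine ENNReal.mul_lt_top ?_ (ENNReal.pow_lt_top hCtop)
  exact (Integrable.fintype_prod (f := fun (_ : {z : Sym2 (Fin d) // ¬ z.IsDiag}) (x : ℝ) =>
    Real.exp (-(κ / m) * |x|)) fun _ =>
      integrable_exp_neg_mul_abs (by positivity)).lintegral_lt_top

/-- For `a ≥ -1/2` the weight `det ^ a * exp (- tr / 2)` has finite mass. -/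
theorem coneMass_one_lt_top (d : ℕ) {a : ℝ} (ha : -(1 / 2) ≤ a) :
    coneMass a (1 : RMat d) < ⊤ := by
  -- `log det (ε Ω) ≤ ε tr Ω - d` turns powers of the determinant into a small exponential
  set q := a + 1 / 2 with hq
  have hq0 : 0 ≤ q := by linarith
  set ε : ℝ := 1 / (4 * (q + 1)) with hε
  have hε0 : 0 < ε := by positivity
  set L := q * (d + d * Real.log ε)
  have hle : ∀ Ω : RMat d, coneWeight a 1 Ω ≤ ENNReal.ofReal (Real.exp (-L)) *
      coneWeight (-(1 / 2)) ((4 * (1 / 8 : ℝ)) • (1 : RMat d)) Ω := by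
    intro Ω
    by_cases hM : Ω.PosDef
    · simp only [coneWeight]
      rw [Set.indicator_of_mem (by exact hM), Set.indicator_of_mem (by exact hM),
        ← ENNReal.ofReal_mul (Real.exp_nonneg _), ← Real.exp_add]
      refine ENNReal.ofReal_le_ofReal (Real.exp_le_exp.2 ?_)
      simp only [Matrix.mul_smul, mul_one, Matrix.trace_smul, smul_eq_mul]
      have h1 := (hM.smul hε0).log_det_le_trace_sub
      rw [Matrix.det_smul, Matrix.trace_smul, smul_eq_mul, Fintype.card_fin,
        Real.log_mul (by positivity) hM.det_pos.ne', Real.log_pow] at h1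
      have h2 := mul_le_mul_of_nonneg_left h1 hq0
      have hT : 0 ≤ Ω.trace := hM.posSemidef.trace_nonneg
      have hqe : q * ε ≤ 1 / 4 := by
        rw [hε, mul_one_div, div_le_div_iff₀ (by positivity) (by norm_num)]
        linarith
      have h3 := mul_le_mul_of_nonneg_right hqe hT
      have h4 : a = q - 1 / 2 := by linarith
      rw [h4]
      simp only [L]
      nlinarith
    · simp only [coneWeight]
      rw [Set.indicator_of_notMem (by exact hM)]
      exact zero_le
  refine (lintegral_mono hle).trans_lt ?_
  rw [lintegral_const_mul _ (measurable_coneWeight _ _)]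
  exact ENNReal.mul_lt_top ENNReal.ofReal_lt_top
    (lintegral_coneWeight_neg_half_lt_top d (by norm_num))

theorem posDef_of_norm_sub_one_lt {d : ℕ} {A : RMat d} (hA : A.IsSymm) (h : ‖A - 1‖ < 1) :
    A.PosDef := by
  rw [posDef_iff_forall_dotProduct]
  refine ⟨hA, fun x hx => ?_⟩
  have h1 := (abs_le.1 (abs_quadForm_le (A - 1) x)).1
  have h2 : 0 < x ⬝ᵥ x := by
    rw [← norm_toLp_sq]
    have : 0 < ‖WithLp.toLp 2 x‖ := by
      rw [norm_pos_iff]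
      simpa using hx
    positivity
  rw [Matrix.sub_mulVec, Matrix.one_mulVec, dotProduct_sub] at h1
  nlinarith

theorem continuous_symMatrix {d : ℕ} : Continuous (symMatrix (d := d)) :=
  continuous_pi fun i => continuous_pi fun j => continuous_apply s(i, j)

theorem symMatrix_isSymm {d : ℕ} (x : Sym2 (Fin d) → ℝ) : (symMatrix x).IsSymm := by
  ext i j
  simp [symMatrix, Sym2.eq_swap]

theorem coneMass_pos {d : ℕ} (a : ℝ) (G : RMat d) : 0 < coneMass a G := by
  rw [coneMass, symLebesgue, lintegral_map (measurable_coneWeight _ _) measurable_symMatrix,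
    lintegral_pos_iff_support (f := fun x => coneWeight a G (symMatrix x)) ((measurable_coneWeight _ _).comp measurable_symMatrix)]
  set U : Set (Sym2 (Fin d) → ℝ) := {x | ‖symMatrix x - 1‖ < 1}
  have hU : IsOpen U :=
    isOpen_lt (continuous_norm.comp (continuous_symMatrix.sub continuous_const)) continuous_const
  have hne : U.Nonempty := by
    refine ⟨fun z => Sym2.lift ⟨fun i j => (1 : RMat d) i j, fun i j => ?_⟩ z, ?_⟩
    · simp [Matrix.one_apply, eq_comm]
    · have : symMatrix (fun z => Sym2.lift ⟨fun i j => (1 : RMat d) i j, fun i j => by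
          simp [Matrix.one_apply, eq_comm]⟩ z) = (1 : RMat d) := by
        ext i j
        simp [symMatrix]
      simp only [U, Set.mem_ofPred_eq, this, sub_self, norm_zero]
      exact one_pos
  refine (hU.measure_pos volume hne).trans_le (measure_mono fun x hx => ?_)
  have hP : (symMatrix x).PosDef := posDef_of_norm_sub_one_lt (symMatrix_isSymm x) hx
  simp only [Function.mem_support, coneWeight]
  rw [Set.indicator_of_mem (by exact hP)]
  exact (ENNReal.ofReal_pos.2 (Real.exp_pos _)).ne'

/-! ### Congruences of symmetric matrices and the Wishart moment generating function -/

/-- The map `Ω ↦ A Ω Aᵀ` on symmetric matrices, in the coordinates of `symMatrix`. -/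
noncomputable def congruence {d : ℕ} (A : RMat d) : (Sym2 (Fin d) → ℝ) →ₗ[ℝ] (Sym2 (Fin d) → ℝ) where
  toFun x z := Sym2.lift ⟨fun i j => (A * symMatrix x * A.transpose) i j, fun i j => by
    have h : (A * symMatrix x * A.transpose).IsSymm := by
      simp [Matrix.IsSymm, Matrix.transpose_mul, (symMatrix_isSymm x).eq, mul_assoc]
    exact h.apply j i⟩ z
  map_add' x y := by
    have h : symMatrix (x + y) = symMatrix x + symMatrix y := rfl
    ext z
    induction z using Sym2.ind with
    | _ i j => simp [h, mul_add, add_mul]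
  map_smul' c x := by
    have h : symMatrix (c • x) = c • symMatrix x := rfl
    ext z
    induction z using Sym2.ind with
    | _ i j => simp [h]

theorem symMatrix_congruence {d : ℕ} (A : RMat d) (x : Sym2 (Fin d) → ℝ) :
    symMatrix (congruence A x) = A * symMatrix x * A.transpose := by
  ext i j
  rfl

theorem symMatrix_injective {d : ℕ} : Function.Injective (symMatrix (d := d)) := by
  intro x y h
  ext z
  induction z using Sym2.ind with
  | _ i j => exact congrFun (congrFun h i) j

theorem congruence_mul {d : ℕ} (A B : RMat d) :
    congruence (A * B) = congruence A ∘ₗ congruence B := by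
  refine LinearMap.ext fun x => symMatrix_injective ?_
  simp only [LinearMap.comp_apply, symMatrix_congruence, Matrix.transpose_mul]
  simp only [mul_assoc]

theorem congruence_one {d : ℕ} : congruence (1 : RMat d) = LinearMap.id := by
  refine LinearMap.ext fun x => symMatrix_injective ?_
  simp [symMatrix_congruence]

theorem prod_sym2_mul {d : ℕ} (e : Fin d → ℝ) (he : ∀ i, 0 < e i) :
    ∏ z : Sym2 (Fin d), Sym2.lift ⟨fun i j => e i * e j, fun _ _ => mul_comm _ _⟩ z
      = (∏ i, e i) ^ (d + 1) := by
  have h1 : ∏ z : Sym2 (Fin d), Sym2.lift ⟨fun i j => e i * e j, fun _ _ => mul_comm _ _⟩ z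
      = ∏ y ∈ (Finset.univ : Finset (Fin d × Fin d)) with y.1 ≤ y.2, e y.1 * e y.2 := by
    rw [← Finset.prod_subtype_eq_prod_filter]
    rw [← Equiv.prod_comp (Sym2.sortEquiv (α := Fin d)).symm]
    refine Finset.prod_bij (fun y _ => y) ?_ ?_ ?_ ?_ <;> aesop
  have h2 : ∏ y ∈ (Finset.univ : Finset (Fin d × Fin d)) with y.2 ≤ y.1, e y.1 * e y.2
      = ∏ y ∈ (Finset.univ : Finset (Fin d × Fin d)) with y.1 ≤ y.2, e y.1 * e y.2 := by
    refine Finset.prod_bij (fun y _ => y.swap) ?_ ?_ ?_ ?_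
    · simp
    · intro a _ b _ h
      exact Prod.swap_injective h
    · intro b hb
      exact ⟨b.swap, by simpa using hb, by simp⟩
    · intro a _
      simp [mul_comm]
  have h3 := Finset.prod_union_inter
    (s₁ := (Finset.univ : Finset (Fin d × Fin d)).filter fun y => y.1 ≤ y.2)
    (s₂ := (Finset.univ : Finset (Fin d × Fin d)).filter fun y => y.2 ≤ y.1)
    (f := fun y => e y.1 * e y.2)
  have hu : ((Finset.univ : Finset (Fin d × Fin d)).filter fun y => y.1 ≤ y.2) ∪
      ((Finset.univ : Finset (Fin d × Fin d)).filter fun y => y.2 ≤ y.1) = Finset.univ := by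
    ext y
    simp [le_total]
  have hi : ((Finset.univ : Finset (Fin d × Fin d)).filter fun y => y.1 ≤ y.2) ∩
      ((Finset.univ : Finset (Fin d × Fin d)).filter fun y => y.2 ≤ y.1)
        = Finset.univ.image fun i : Fin d => (i, i) := by
    ext ⟨i, j⟩
    simp only [Finset.mem_inter, Finset.mem_filter, Finset.mem_univ, true_and, Finset.mem_image,
      Prod.mk.injEq]
    constructor
    · exact fun h => ⟨i, rfl, le_antisymm h.1 h.2⟩
    · rintro ⟨a, rfl, rfl⟩
      exact ⟨le_rfl, le_rfl⟩
  rw [hu, hi, Finset.prod_image (fun a _ b _ h => (Prod.mk.inj h).1), h2] at h3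
  have h4 : ∏ y : Fin d × Fin d, e y.1 * e y.2 = (∏ i, e i) ^ d * (∏ i, e i) ^ d := by
    rw [Finset.prod_mul_distrib, Fintype.prod_prod_type, Fintype.prod_prod_type]
    simp [Finset.prod_pow]
  rw [h4, Finset.prod_mul_distrib] at h3
  rw [h1]
  have hpos : 0 < ∏ i, e i := Finset.prod_pos fun i _ => he i
  have hP : 0 < ∏ y ∈ (Finset.univ : Finset (Fin d × Fin d)) with y.1 ≤ y.2, e y.1 * e y.2 :=
    Finset.prod_pos fun y _ => mul_pos (he _) (he _)
  refine (pow_left_inj₀ hP.le (by positivity) two_ne_zero).1 ?_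
  rw [sq, ← h3]
  ring

theorem det_congruence_diagonal {d : ℕ} (e : Fin d → ℝ) (he : ∀ i, 0 < e i) :
    LinearMap.det (congruence (Matrix.diagonal e)) = (∏ i, e i) ^ (d + 1) := by
  rw [← prod_sym2_mul e he, ← Matrix.det_diagonal, ← LinearMap.det_toLin']
  congr 1
  refine LinearMap.ext fun x => funext fun z => ?_
  rw [Matrix.toLin'_apply, Matrix.mulVec_diagonal]
  induction z using Sym2.ind with
  | _ i j =>
    change (Matrix.diagonal e * symMatrix x * (Matrix.diagonal e).transpose) i j = e i * e j * x s(i, j)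
    rw [Matrix.diagonal_transpose, Matrix.mul_diagonal, Matrix.diagonal_mul]
    simp only [symMatrix, Matrix.of_apply]
    ring

/-- The Jacobian of a congruence. -/
theorem Matrix.PosDef.det_congruence {d : ℕ} {A : RMat d} (hA : A.PosDef) :
    LinearMap.det (congruence A) = A.det ^ (d + 1) := by
  have hdet : A.det = ∏ i, hA.1.eigenvalues i := by
    simpa using hA.1.det_eq_prod_eigenvalues
  set U : RMat d := hA.1.eigenvectorUnitary.1 with hU
  have hspec : A = U * Matrix.diagonal hA.1.eigenvalues * star U := by
    conv_lhs => rw [hA.1.spectral_theorem]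
    rfl
  have hUU : U * star U = 1 := Unitary.mul_star_self_of_mem hA.1.eigenvectorUnitary.2
  have h1 : LinearMap.det (congruence U) * LinearMap.det (congruence (star U)) = 1 := by
    rw [← LinearMap.det_comp, ← congruence_mul, hUU, congruence_one, LinearMap.det_id]
  rw [hdet, ← det_congruence_diagonal _ hA.eigenvalues_pos]
  conv_lhs => rw [hspec]
  rw [congruence_mul, congruence_mul, LinearMap.det_comp, LinearMap.det_comp]
  linear_combination LinearMap.det (congruence (Matrix.diagonal hA.1.eigenvalues)) * h1

/-- The total mass scales like `det G ^ (-N / 2)`, with `N = 2 a + d + 1` degrees of freedom. -/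
theorem coneMass_eq {d : ℕ} (a : ℝ) {G : RMat d} (hG : G.PosDef) :
    coneMass a G = ENNReal.ofReal (Real.exp (-((2 * a + d + 1) / 2) * Real.log G.det)) *
      coneMass a (1 : RMat d) := by
  set R := CFC.sqrt G with hR
  have hRp : R.PosDef := hG.sqrt
  have hRR : R * R = G := hG.sqrt_mul_self
  have hRs : R.transpose = R := hRp.isSymm_real
  have hRd : R.det * R.det = G.det := by rw [← Matrix.det_mul, hRR]
  have hd0 := hRp.det_pos
  have hlog : Real.log G.det = 2 * Real.log R.det := by
    rw [← hRd, Real.log_mul hd0.ne' hd0.ne']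
    ring
  have hL0 : LinearMap.det (congruence R) ≠ 0 := by
    rw [hRp.det_congruence]
    exact (pow_pos hd0 _).ne'
  have hcm : Measurable (congruence R) :=
    (LinearMap.continuous_of_finiteDimensional _).measurable
  have hm1 : Measurable fun x : Sym2 (Fin d) → ℝ => coneWeight a (1 : RMat d) (symMatrix x) :=
    (measurable_coneWeight _ _).comp measurable_symMatrix
  have hpt : ∀ Ω : RMat d, coneWeight a G Ω = ENNReal.ofReal (Real.exp (-(a * Real.log G.det))) *
      coneWeight a 1 (R * Ω * R.transpose) := by
    intro Ω
    have hiff : (R * Ω * R.transpose).PosDef ↔ Ω.PosDef := by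
      rw [← Matrix.conjTranspose_eq_transpose_of_trivial]
      exact Matrix.IsUnit.posDef_star_right_conjugate_iff hRp.isUnit
    by_cases hM : Ω.PosDef
    · simp only [coneWeight]
      rw [Set.indicator_of_mem (by exact hM), Set.indicator_of_mem (by exact hiff.2 hM),
        ← ENNReal.ofReal_mul (Real.exp_nonneg _), ← Real.exp_add]
      have e1 : (R * Ω * R.transpose).det = G.det * Ω.det := by
        rw [Matrix.det_mul, Matrix.det_mul, hRs, ← hRd]
        ring
      have e2 : (R * Ω * R.transpose * 1).trace = (Ω * G).trace := by
        rw [mul_one, hRs, mul_assoc, Matrix.trace_mul_comm, mul_assoc, hRR]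
      rw [e1, e2, Real.log_mul hG.det_pos.ne' hM.det_pos.ne']
      congr 2
      ring
    · simp only [coneWeight]
      rw [Set.indicator_of_notMem (by exact hM),
        Set.indicator_of_notMem (by exact fun h => hM (hiff.1 h)), mul_zero]
  rw [coneMass, symLebesgue, lintegral_map (measurable_coneWeight _ _) measurable_symMatrix]
  simp only [hpt]
  rw [lintegral_const_mul _ (f := fun x : Sym2 (Fin d) → ℝ =>
    coneWeight a 1 (R * symMatrix x * R.transpose)) ((measurable_coneWeight a 1).comp
    (((continuous_const.matrix_mul continuous_symMatrix).matrix_mul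
      continuous_const).measurable))]
  have hcomp : ∫⁻ x : Sym2 (Fin d) → ℝ, coneWeight a 1 (R * symMatrix x * R.transpose)
      = ENNReal.ofReal |(LinearMap.det (congruence R))⁻¹| * coneMass a (1 : RMat d) := by
    simp only [← symMatrix_congruence]
    rw [← lintegral_map (f := fun x : Sym2 (Fin d) → ℝ => coneWeight a (1 : RMat d) (symMatrix x))
      hm1 hcm, Measure.map_linearMap_addHaar_eq_smul_addHaar _ hL0, lintegral_smul_measure,
      coneMass, symLebesgue, lintegral_map (measurable_coneWeight _ _) measurable_symMatrix,
      smul_eq_mul]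
  rw [hcomp, ← mul_assoc, ← ENNReal.ofReal_mul (Real.exp_nonneg _), hRp.det_congruence, abs_of_pos
    (by positivity), hlog]
  congr 2
  rw [← Real.exp_log (inv_pos.2 (pow_pos hd0 (d + 1))), Real.log_inv, Real.log_pow, ← Real.exp_add]
  congr 1
  push_cast
  ring

theorem coneMass_lt_top {d : ℕ} {a : ℝ} (ha : -(1 / 2) ≤ a) {G : RMat d} (hG : G.PosDef) :
    coneMass a G < ⊤ := by
  rw [coneMass_eq a hG]
  exact ENNReal.mul_lt_top ENNReal.ofReal_lt_top (coneMass_one_lt_top d ha)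

theorem dotProduct_sq_le {d : ℕ} (u v : Fin d → ℝ) : (u ⬝ᵥ v) ^ 2 ≤ (u ⬝ᵥ u) * (v ⬝ᵥ v) := by
  simp only [dotProduct, ← sq]
  exact Finset.sum_mul_sq_le_sq_mul_sq _ _ _

theorem posDef_one_sub_vecMulVec {d : ℕ} {u : Fin d → ℝ} (hu : u ⬝ᵥ u = 1) {c : ℝ} (hc : c < 1) :
    (1 - c • Matrix.vecMulVec u u : RMat d).PosDef := by
  rw [posDef_iff_forall_dotProduct]
  refine ⟨?_, fun x hx => ?_⟩
  · ext i j
    simp [Matrix.vecMulVec_apply, Matrix.one_apply, mul_comm, eq_comm]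
  · have h1 := dotProduct_sq_le u x
    have h2 : 0 < x ⬝ᵥ x := by
      rw [← norm_toLp_sq]
      have : 0 < ‖WithLp.toLp 2 x‖ := by
        rw [norm_pos_iff]
        simpa using hx
      positivity
    have h3 : x ⬝ᵥ (Matrix.vecMulVec u u).mulVec x = (u ⬝ᵥ x) ^ 2 := by
      rw [Matrix.vecMulVec_mulVec]
      simp [dotProduct_smul, dotProduct_comm x u, sq]
    rw [hu, one_mul] at h1
    rw [Matrix.sub_mulVec, Matrix.one_mulVec, dotProduct_sub, Matrix.smul_mulVec, dotProduct_smul,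
      h3, smul_eq_mul]
    rcases le_total c 0 with h | h <;> nlinarith [sq_nonneg (u ⬝ᵥ x)]

theorem det_one_sub_smul_vecMulVec {d : ℕ} (u : Fin d → ℝ) (c : ℝ) :
    (1 - c • Matrix.vecMulVec u u : RMat d).det = 1 - c * (u ⬝ᵥ u) := by
  have h := Matrix.det_one_add_replicateCol_mul_replicateRow (ι := Unit) (-(c • u)) u
  rw [← Matrix.vecMulVec_eq] at h
  rw [sub_eq_add_neg, ← neg_smul, ← Matrix.smul_vecMulVec, neg_smul, h, dotProduct_neg,
    dotProduct_smul, smul_eq_mul, sub_eq_add_neg]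

/-- The moment generating function of a quadratic form in a Wishart matrix: that of a
chi-squared variable with `2 a + d + 1` degrees of freedom. -/
theorem lintegral_exp_quadForm_coneWeight {d : ℕ} (a : ℝ) {R : RMat d} (hR : R.PosDef)
    {u : Fin d → ℝ} (hu : u ⬝ᵥ u = 1) {s : ℝ} (hs : 2 * s < 1) :
    ∫⁻ Ω, ENNReal.ofReal (Real.exp (s * (u ⬝ᵥ (R * Ω * R).mulVec u))) * coneWeight a (R * R) Ω
      ∂symLebesgue d =
    ENNReal.ofReal (Real.exp (-((2 * a + d + 1) / 2) * Real.log (1 - 2 * s))) *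
      coneMass a (R * R) := by
  have hRs : R.transpose = R := hR.isSymm_real
  have hinj : Function.Injective R.mulVec := Matrix.mulVec_injective_iff_isUnit.2 hR.isUnit
  have hRR : (R * R).PosDef := by
    have := Matrix.PosDef.one.conjTranspose_mul_mul_same hinj
    rwa [Matrix.conjTranspose_eq_transpose_of_trivial, hRs, mul_one] at this
  set K : RMat d := 1 - (2 * s) • Matrix.vecMulVec u u with hK
  have hKp : K.PosDef := posDef_one_sub_vecMulVec hu hs
  have hG' : (R * K * R).PosDef := by
    have := hKp.conjTranspose_mul_mul_same hinj
    rwa [Matrix.conjTranspose_eq_transpose_of_trivial, hRs] at this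
  have hdet : (R * K * R).det = (R * R).det * (1 - 2 * s) := by
    rw [Matrix.det_mul, Matrix.det_mul, Matrix.det_mul, det_one_sub_smul_vecMulVec, hu]
    ring
  have hpt : ∀ Ω : RMat d, ENNReal.ofReal (Real.exp (s * (u ⬝ᵥ (R * Ω * R).mulVec u))) *
      coneWeight a (R * R) Ω = coneWeight a (R * K * R) Ω := by
    intro Ω
    by_cases hM : Ω.PosDef
    · simp only [coneWeight]
      rw [Set.indicator_of_mem (by exact hM), Set.indicator_of_mem (by exact hM),
        ← ENNReal.ofReal_mul (Real.exp_nonneg _), ← Real.exp_add]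
      have htr : (Ω * (R * K * R)).trace
          = (Ω * (R * R)).trace - 2 * s * (u ⬝ᵥ (R * Ω * R).mulVec u) := by
        have e1 : (Ω * (R * Matrix.vecMulVec u u * R)).trace = u ⬝ᵥ (R * Ω * R).mulVec u := by
          rw [← mul_assoc, Matrix.trace_mul_comm, ← mul_assoc, ← mul_assoc,
            Matrix.mul_vecMulVec, Matrix.trace_vecMulVec, dotProduct_comm]
        rw [← e1, hK]
        simp only [mul_sub, sub_mul, mul_one, Matrix.mul_smul, Matrix.smul_mul, Matrix.trace_sub,
          Matrix.trace_smul, smul_eq_mul]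
      rw [htr]
      congr 2
      ring
    · simp only [coneWeight]
      rw [Set.indicator_of_notMem (by exact hM), Set.indicator_of_notMem (by exact hM), mul_zero]
  simp only [hpt]
  change coneMass a (R * K * R) = _
  rw [coneMass_eq a hG', coneMass_eq a hRR, ← mul_assoc, ← ENNReal.ofReal_mul (Real.exp_nonneg _),
    ← Real.exp_add, hdet, Real.log_mul hRR.det_pos.ne' (by linarith)]
  congr 3
  ring

/-! ### The chi-squared moment generating function of Gaussian samples -/

theorem lintegral_exp_mul_sq_gaussianReal {s : ℝ} (hs : 2 * s < 1) :
    ∫⁻ x, ENNReal.ofReal (Real.exp (s * x ^ 2)) ∂gaussianReal 0 1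
      = ENNReal.ofReal (Real.exp (-(1 / 2) * Real.log (1 - 2 * s))) := by
  have hb : 0 < 1 / 2 - s := by linarith
  rw [gaussianReal_of_var_ne_zero 0 one_ne_zero,
    lintegral_withDensity_eq_lintegral_mul _ (measurable_gaussianPDF 0 1) (by fun_prop)]
  have hpt : ∀ x : ℝ, (gaussianPDF 0 1 * fun x => ENNReal.ofReal (Real.exp (s * x ^ 2))) x
      = ENNReal.ofReal ((Real.sqrt (2 * Real.pi))⁻¹ * Real.exp (-(1 / 2 - s) * x ^ 2)) := by
    intro x
    rw [Pi.mul_apply, gaussianPDF, ← ENNReal.ofReal_mul (gaussianPDFReal_nonneg _ _ _),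
      gaussianPDFReal, mul_assoc, ← Real.exp_add]
    simp only [NNReal.coe_one, mul_one, sub_zero]
    congr 3
    ring
  simp only [hpt]
  rw [← ofReal_integral_eq_lintegral_ofReal ((integrable_exp_neg_mul_sq hb).const_mul _)
    (ae_of_all _ fun x => by positivity), integral_const_mul, integral_gaussian]
  congr 1
  have hp := Real.pi_pos
  rw [← Real.sqrt_inv, ← Real.sqrt_mul (by positivity)]
  have h1 : (2 * Real.pi)⁻¹ * (Real.pi / (1 / 2 - s)) = (1 - 2 * s)⁻¹ := by
    have : 1 - 2 * s ≠ 0 := by linarith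
    field_simp
  rw [h1, Real.sqrt_eq_rpow, Real.rpow_def_of_pos (inv_pos.2 (by linarith)), Real.log_inv]
  congr 1
  ring

theorem map_inner_multivariateGaussian {d : ℕ} {S : RMat d} (hS : S.PosDef) {w : Fin d → ℝ}
    (hw : w ⬝ᵥ S.mulVec w = 1) :
    (multivariateGaussian 0 S).map (fun x => w ⬝ᵥ x.ofLp) = gaussianReal 0 1 := by
  have h := IsGaussian.map_eq_gaussianReal (μ := multivariateGaussian 0 S)
    (innerSL ℝ (WithLp.toLp 2 w))
  have hL : ∀ x : EuclideanSpace ℝ (Fin d), innerSL ℝ (WithLp.toLp 2 w) x = w ⬝ᵥ x.ofLp := by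
    intro x
    rw [innerSL_apply_apply, EuclideanSpace.inner_eq_star_dotProduct]
    simp [dotProduct_comm]
  have hmean : (multivariateGaussian 0 S)[innerSL ℝ (WithLp.toLp 2 w)] = 0 := by
    rw [ContinuousLinearMap.integral_comp_id_comm IsGaussian.integrable_id,
      integral_id_multivariateGaussian, map_zero]
  have hvar : Var[innerSL ℝ (WithLp.toLp 2 w); multivariateGaussian 0 S] = 1 := by
    have h1 := covarianceBilin_self (μ := multivariateGaussian 0 S)
      (IsGaussian.memLp_two_id) (WithLp.toLp 2 w)
    rw [covarianceBilin_multivariateGaussian hS.posSemidef, hw] at h1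
    exact h1.symm
  rw [hmean, hvar, Real.toNNReal_one] at h
  rw [← h]
  congr 1
  ext x
  exact (hL x).symm

theorem quadForm_sampleCov {n d : ℕ} (hn : n ≠ 0) (X : Sample n d) (w : Fin d → ℝ) :
    w ⬝ᵥ ((n : ℝ) • sampleCov X).mulVec w = ∑ i, (w ⬝ᵥ (X i).ofLp) ^ 2 := by
  have hn' : (n : ℝ) ≠ 0 := by exact_mod_cast hn
  rw [sampleCov, smul_smul, mul_inv_cancel₀ hn', one_smul, Matrix.sum_mulVec, dotProduct_sum]
  refine Finset.sum_congr rfl fun i _ => ?_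
  rw [Matrix.vecMulVec_mulVec]
  simp [dotProduct_smul, dotProduct_comm w (X i).ofLp, sq]

theorem lintegral_exp_quadForm_sampleCov {n d : ℕ} (hn : n ≠ 0) {S : RMat d} (hS : S.PosDef)
    {w : Fin d → ℝ} (hw : w ⬝ᵥ S.mulVec w = 1) {s : ℝ} (hs : 2 * s < 1) :
    ∫⁻ X, ENNReal.ofReal (Real.exp (s * (w ⬝ᵥ ((n : ℝ) • sampleCov X).mulVec w))) ∂sampleLaw n S
      = ENNReal.ofReal (Real.exp (-(n / 2) * Real.log (1 - 2 * s))) := by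
  have hmeas : Measurable fun x : EuclideanSpace ℝ (Fin d) => w ⬝ᵥ x.ofLp := by
    have : Continuous fun x : EuclideanSpace ℝ (Fin d) => w ⬝ᵥ x.ofLp :=
      Continuous.dotProduct continuous_const (PiLp.continuous_ofLp 2 _)
    exact this.measurable
  set f : EuclideanSpace ℝ (Fin d) → ℝ := fun x => Real.exp (s * (w ⬝ᵥ x.ofLp) ^ 2)
  have hf : Measurable f := Real.measurable_exp.comp ((hmeas.pow_const 2).const_mul s)
  have hl : ∫⁻ x, ENNReal.ofReal (f x) ∂multivariateGaussian 0 S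
      = ENNReal.ofReal (Real.exp (-(1 / 2) * Real.log (1 - 2 * s))) := by
    rw [← lintegral_exp_mul_sq_gaussianReal hs, ← map_inner_multivariateGaussian hS hw,
      lintegral_map (by fun_prop) hmeas]
  have hint : Integrable f (multivariateGaussian 0 S) := by
    refine ⟨hf.aestronglyMeasurable, ?_⟩
    rw [hasFiniteIntegral_iff_ofReal (ae_of_all _ fun x => Real.exp_nonneg _), hl]
    exact ENNReal.ofReal_lt_top
  have hval : ∫ x, f x ∂multivariateGaussian 0 S
      = Real.exp (-(1 / 2) * Real.log (1 - 2 * s)) := by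
    rw [integral_eq_lintegral_of_nonneg_ae (ae_of_all _ fun x => Real.exp_nonneg _)
      hf.aestronglyMeasurable, hl, ENNReal.toReal_ofReal (Real.exp_nonneg _)]
  have hprod : ∀ X : Sample n d,
      Real.exp (s * (w ⬝ᵥ ((n : ℝ) • sampleCov X).mulVec w)) = ∏ i, f (X i) := by
    intro X
    rw [quadForm_sampleCov hn, Finset.mul_sum, Real.exp_sum]
  simp only [hprod]
  rw [sampleLaw, ← ofReal_integral_eq_lintegral_ofReal
    (Integrable.fintype_prod (f := fun _ => f) fun _ => hint)
    (ae_of_all _ fun X => Finset.prod_nonneg fun _ _ => Real.exp_nonneg _),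
    integral_fintype_prod_eq_pow, hval, ← Real.exp_nat_mul, Fintype.card_fin]
  congr 2
  ring

/-! ### Spectral deviations from chi-squared quadratic forms -/

theorem neg_half_log_one_sub_le {s : ℝ} (hs : |s| ≤ 1 / 4) :
    -(1 / 2) * Real.log (1 - 2 * s) ≤ s + 4 * s ^ 2 := by
  have h2 : |2 * s| ≤ 1 / 2 := by
    rw [abs_mul, abs_two]
    linarith
  have h := Real.abs_log_sub_add_sum_range_le (x := 2 * s) (by linarith) 1
  simp only [Finset.sum_range_one, zero_add, pow_one, Nat.cast_zero, div_one] at h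
  have h3 : |2 * s| ^ (1 + 1) / (1 - |2 * s|) ≤ 8 * s ^ 2 := by
    rw [div_le_iff₀ (by linarith)]
    have : |2 * s| ^ (1 + 1) = 4 * s ^ 2 := by
      rw [one_add_one_eq_two, sq_abs]
      ring
    rw [this]
    nlinarith [sq_nonneg s]
  have := (abs_le.1 (h.trans h3)).1
  linarith

/-- If the quadratic forms of a random symmetric matrix have the moment generating function of a
chi-squared variable with `N` degrees of freedom, the matrix is close to `N` times the identity in
spectral norm: a Chernoff bound at each point of a net of the sphere. -/
theorem measure_norm_sub_gt_le {α : Type*} [MeasurableSpace α] {d : ℕ} (μ : Measure α)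
    (T : α → RMat d) (hT : ∀ u : Fin d → ℝ, Measurable fun ω => u ⬝ᵥ (T ω).mulVec u)
    {N : ℝ} (hN : 0 ≤ N) (m : ENNReal)
    (hmgf : ∀ u : Fin d → ℝ, u ⬝ᵥ u = 1 → ∀ s : ℝ, |s| ≤ 1 / 4 →
      ∫⁻ ω, ENNReal.ofReal (Real.exp (s * (u ⬝ᵥ (T ω).mulVec u))) ∂μ
        ≤ ENNReal.ofReal (Real.exp (-(N / 2) * Real.log (1 - 2 * s))) * m)
    {η : ℝ} (hη0 : 0 ≤ η) (hη1 : η ≤ 1) :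
    μ {ω | (T ω).IsSymm ∧ η * N < ‖T ω - N • (1 : RMat d)‖}
      ≤ ENNReal.ofReal (2 * 5 ^ d * Real.exp (-(N * η ^ 2 / 16384))) * m := by
  obtain ⟨net, hcard, hunit, hnet⟩ := exists_finset_norm_le d
  set B : ENNReal := ENNReal.ofReal (Real.exp (-(N * η ^ 2 / 16384))) * m with hB
  have htail : ∀ x ∈ net, ∀ s : ℝ, |s| = η / 256 →
      μ {ω | s * N + η ^ 2 / 8192 * N ≤ s * (x ⬝ᵥ (T ω).mulVec x)} ≤ B := by
    intro x hx s hs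
    have hs4 : |s| ≤ 1 / 4 := by linarith
    set E : ENNReal := ENNReal.ofReal (Real.exp (s * N + η ^ 2 / 8192 * N)) with hE
    have hE0 : E ≠ 0 := (ENNReal.ofReal_pos.2 (Real.exp_pos _)).ne'
    have h1 := mul_meas_ge_le_lintegral (μ := μ)
      (f := fun ω => ENNReal.ofReal (Real.exp (s * (x ⬝ᵥ (T ω).mulVec x))))
      (Real.measurable_exp.comp ((hT x).const_mul s)).ennreal_ofReal E
    have hset : {ω | s * N + η ^ 2 / 8192 * N ≤ s * (x ⬝ᵥ (T ω).mulVec x)}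
        ⊆ {ω | E ≤ ENNReal.ofReal (Real.exp (s * (x ⬝ᵥ (T ω).mulVec x)))} := fun ω hω =>
      ENNReal.ofReal_le_ofReal (Real.exp_le_exp.2 hω)
    have h2 := (mul_le_mul_right (measure_mono hset) E).trans
      (h1.trans (hmgf x (hunit x hx) s hs4))
    have h3 : ENNReal.ofReal (Real.exp (-(N / 2) * Real.log (1 - 2 * s))) * m ≤ E * B := by
      rw [hB, ← mul_assoc, hE, ← ENNReal.ofReal_mul (Real.exp_nonneg _), ← Real.exp_add]
      refine mul_le_mul_left (ENNReal.ofReal_le_ofReal (Real.exp_le_exp.2 ?_)) m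
      have h4 := mul_le_mul_of_nonneg_left (neg_half_log_one_sub_le hs4) hN
      have h5 : s ^ 2 = η ^ 2 / 65536 := by
        rw [← sq_abs, hs]
        ring
      rw [h5] at h4
      linarith
    exact (ENNReal.mul_le_mul_iff_right hE0 ENNReal.ofReal_ne_top).1 (h2.trans h3)
  have hsub : {ω | (T ω).IsSymm ∧ η * N < ‖T ω - N • (1 : RMat d)‖} ⊆
      ⋃ x ∈ net, ({ω | η / 256 * N + η ^ 2 / 8192 * N ≤ η / 256 * (x ⬝ᵥ (T ω).mulVec x)} ∪
        {ω | -(η / 256) * N + η ^ 2 / 8192 * N ≤ -(η / 256) * (x ⬝ᵥ (T ω).mulVec x)}) := by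
    rintro ω ⟨hsymm, hω⟩
    by_contra hcon
    simp only [Set.mem_iUnion, Set.mem_union, Set.mem_ofPred_eq, not_exists, not_or, not_le]
      at hcon
    have hs' : (T ω - N • (1 : RMat d)).IsSymm := hsymm.sub (Matrix.isSymm_one.smul N)
    refine absurd (hnet _ hs' (η * N / 32) (by positivity) fun x hx => ?_)
      (by rw [not_le]; linarith)
    obtain ⟨h1, h2⟩ := hcon x hx
    have hη : 0 < η := by
      rcases hη0.eq_or_lt with h | h
      · rw [← h] at h1
        simp at h1
      · exact h
    rw [Matrix.sub_mulVec, Matrix.smul_mulVec, Matrix.one_mulVec, dotProduct_sub, dotProduct_smul,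
      hunit x hx, smul_eq_mul, mul_one, abs_le]
    constructor <;> nlinarith
  refine (measure_mono hsub).trans ((measure_biUnion_finset_le _ _).trans ?_)
  have habs : |η / 256| = η / 256 := abs_of_nonneg (by positivity)
  calc ∑ x ∈ net, μ ({ω | η / 256 * N + η ^ 2 / 8192 * N ≤ η / 256 * (x ⬝ᵥ (T ω).mulVec x)} ∪
        {ω | -(η / 256) * N + η ^ 2 / 8192 * N ≤ -(η / 256) * (x ⬝ᵥ (T ω).mulVec x)})
      ≤ ∑ _x ∈ net, (2 * B) := by
        refine Finset.sum_le_sum fun x hx => (measure_union_le _ _).trans ?_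
        rw [two_mul]
        exact add_le_add (htail x hx _ habs) (htail x hx _ (by rw [abs_neg, habs]))
    _ = (net.card : ENNReal) * (2 * B) := by rw [Finset.sum_const, nsmul_eq_mul]
    _ ≤ (5 ^ d : ENNReal) * (2 * B) := by
        refine mul_le_mul_left ?_ _
        exact_mod_cast hcard
    _ = _ := by
        rw [hB, ENNReal.ofReal_mul (by positivity), ENNReal.ofReal_mul (by positivity),
          ENNReal.ofReal_pow (by norm_num)]
        simp only [ENNReal.ofReal_ofNat]
        ring

/-! ### The posterior as a normalized measure on the cone -/

/-- The measure with density `coneWeight a G` on symmetric matrices. -/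
noncomputable def coneMeasure {d : ℕ} (a : ℝ) (G : RMat d) : Measure (RMat d) :=
  (symLebesgue d).withDensity (coneWeight a G)

theorem coneMeasure_univ {d : ℕ} (a : ℝ) (G : RMat d) :
    coneMeasure a G Set.univ = coneMass a G := by
  rw [coneMeasure, withDensity_apply _ MeasurableSet.univ, Measure.restrict_univ]
  rfl

theorem wishartWeight_eq (d : ℕ) (b : ℤ) :
    wishartWeight d b = coneWeight (((b : ℝ) - 2) / 2) 1 := by
  unfold wishartWeight coneWeight
  simp only [mul_one]

theorem measurable_logLik {n d : ℕ} (X : Sample n d) : Measurable (logLik X) :=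
  ((measurable_det d).log.const_mul _).sub ((measurable_trace_mul _).const_mul _)

theorem measurableSet_covBall {d : ℕ} (S : RMat d) (ρ : ℝ) : MeasurableSet (covBall S ρ) := by
  have hinv : Measurable fun A : RMat d => A⁻¹ := by
    have h : (fun A : RMat d => A⁻¹) = fun A => (A.det)⁻¹ • A.adjugate := by
      ext1 A
      rw [Matrix.inv_def, Ring.inverse_eq_inv']
    rw [h]
    have h2 : Measurable fun A : RMat d => A.adjugate :=
      (Continuous.matrix_adjugate continuous_id).measurable
    refine measurable_pi_lambda _ fun i => measurable_pi_lambda _ fun j => ?_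
    exact (measurable_det d).inv.mul
      ((measurable_pi_apply j).comp ((measurable_pi_apply i).comp h2))
  have hn : Measurable fun A : RMat d => ‖A - S‖ :=
    (continuous_norm.comp (continuous_id.sub continuous_const)).measurable
  exact (measurableSet_posDef d).inter (measurableSet_le (hn.comp hinv) measurable_const)

theorem covBall_mono {d : ℕ} (S : RMat d) {ρ ρ' : ℝ} (h : ρ ≤ ρ') :
    covBall S ρ ⊆ covBall S ρ' := fun _ hΩ => ⟨hΩ.1, hΩ.2.trans h⟩

/-- The normalizing constant of the Wishart prior. -/
noncomputable def wishartConst (d : ℕ) (b : ℤ) : ENNReal :=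
  (coneMass (((b : ℝ) - 2) / 2) (1 : RMat d))⁻¹

theorem setIntegral_wishart {d : ℕ} (b : ℤ) {A : Set (RMat d)} (hA : MeasurableSet A)
    {f : RMat d → ℝ} (hf : Measurable f) (hf0 : ∀ Ω, 0 ≤ f Ω) :
    ∫ Ω in A, f Ω ∂wishart d b = (wishartConst d b * ∫⁻ Ω in A,
      ENNReal.ofReal (f Ω) * coneWeight (((b : ℝ) - 2) / 2) 1 Ω ∂symLebesgue d).toReal := by
  rw [integral_eq_lintegral_of_nonneg_ae (ae_of_all _ hf0) hf.aestronglyMeasurable, wishart,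
    wishartWeight_eq]
  change (∫⁻ Ω in A, ENNReal.ofReal (f Ω) ∂((coneMeasure (((b : ℝ) - 2) / 2) (1 : RMat d)
    Set.univ)⁻¹ • (symLebesgue d).withDensity (coneWeight (((b : ℝ) - 2) / 2) 1))).toReal = _
  rw [coneMeasure_univ, Measure.restrict_smul, lintegral_smul_measure, restrict_withDensity hA,
    lintegral_withDensity_eq_lintegral_mul _ (measurable_coneWeight _ _) hf.ennreal_ofReal]
  simp only [Pi.mul_apply, smul_eq_mul, wishartConst, mul_comm (ENNReal.ofReal _)]

theorem exp_logLik_mul_coneWeight {n d : ℕ} (X : Sample n d) (b : ℤ) (Ω : RMat d) :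
    ENNReal.ofReal (Real.exp (logLik X Ω)) * coneWeight (((b : ℝ) - 2) / 2) 1 Ω
      = coneWeight (((n : ℝ) + b - 2) / 2) ((n : ℝ) • sampleCov X + 1) Ω := by
  by_cases hM : Ω.PosDef
  · simp only [coneWeight]
    rw [Set.indicator_of_mem (by exact hM), Set.indicator_of_mem (by exact hM),
      ← ENNReal.ofReal_mul (Real.exp_nonneg _), ← Real.exp_add, logLik]
    congr 2
    simp only [mul_add, mul_one, Matrix.mul_smul, Matrix.trace_add, Matrix.trace_smul, smul_eq_mul]
    ring
  · simp only [coneWeight]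
    rw [Set.indicator_of_notMem (by exact hM), Set.indicator_of_notMem (by exact hM), mul_zero]

theorem wishartConst_ne_zero {d : ℕ} {b : ℤ} (hb : 1 ≤ b) : wishartConst d b ≠ 0 := by
  have : (1 : ℝ) ≤ b := by exact_mod_cast hb
  exact ENNReal.inv_ne_zero.2 (coneMass_one_lt_top d (by linarith)).ne

theorem wishartConst_ne_top (d : ℕ) (b : ℤ) : wishartConst d b ≠ ⊤ :=
  ENNReal.inv_ne_top.2 (coneMass_pos _ _).ne'

theorem setIntegral_exp_logLik {n d : ℕ} (X : Sample n d) (b : ℤ) {A : Set (RMat d)}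
    (hA : MeasurableSet A) : ∫ Ω in A, Real.exp (logLik X Ω) ∂wishart d b =
      (wishartConst d b).toReal *
        (coneMeasure (((n : ℝ) + b - 2) / 2) ((n : ℝ) • sampleCov X + 1) A).toReal := by
  rw [setIntegral_wishart b hA (f := fun Ω => Real.exp (logLik X Ω)) (Real.measurable_exp.comp (measurable_logLik X))
    (fun Ω => Real.exp_nonneg _), ENNReal.toReal_mul, coneMeasure, withDensity_apply _ hA]
  simp only [exp_logLik_mul_coneWeight]

theorem wishartConst_toReal_pos {d : ℕ} {b : ℤ} (hb : 1 ≤ b) : 0 < (wishartConst d b).toReal :=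
  ENNReal.toReal_pos (wishartConst_ne_zero hb) (wishartConst_ne_top d b)

theorem posterior_wishart {n d : ℕ} (X : Sample n d) {b : ℤ} (hb : 1 ≤ b) {A : Set (RMat d)}
    (hA : MeasurableSet A) : posterior (wishart d b) X A =
      (coneMeasure (((n : ℝ) + b - 2) / 2) ((n : ℝ) • sampleCov X + 1) A).toReal /
      (coneMeasure (((n : ℝ) + b - 2) / 2) ((n : ℝ) • sampleCov X + 1) Set.univ).toReal := by
  have h := setIntegral_exp_logLik X b MeasurableSet.univ
  rw [Measure.restrict_univ] at h
  rw [_root_.posterior, setIntegral_exp_logLik X b hA, h,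
    mul_div_mul_left _ _ (wishartConst_toReal_pos hb).ne']

theorem posDef_smul_sampleCov_add_one {n d : ℕ} (X : Sample n d) :
    ((n : ℝ) • sampleCov X + 1 : RMat d).PosDef := by
  refine Matrix.PosDef.posSemidef_add (Matrix.PosSemidef.smul ?_ (Nat.cast_nonneg n))
    Matrix.PosDef.one
  refine Matrix.PosSemidef.smul (Matrix.posSemidef_sum _ fun i _ => ?_) (by positivity)
  simpa using Matrix.posSemidef_vecMulVec_self_star (X i).ofLp

theorem coneMeasure_univ_lt_top {n d : ℕ} (X : Sample n d) {b : ℤ} (hb : 1 ≤ b) :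
    coneMeasure (((n : ℝ) + b - 2) / 2) ((n : ℝ) • sampleCov X + 1) (Set.univ : Set (RMat d))
      < ⊤ := by
  have : (1 : ℝ) ≤ b := by exact_mod_cast hb
  have hn : (0 : ℝ) ≤ n := Nat.cast_nonneg n
  rw [coneMeasure_univ]
  exact coneMass_lt_top (by linarith) (posDef_smul_sampleCov_add_one X)

theorem coneMeasure_univ_pos {d : ℕ} (a : ℝ) (G : RMat d) :
    0 < coneMeasure a G (Set.univ : Set (RMat d)) := by
  rw [coneMeasure_univ]
  exact coneMass_pos a G

theorem posterior_wishart_le_one {n d : ℕ} (X : Sample n d) {b : ℤ} (hb : 1 ≤ b)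
    {A : Set (RMat d)} (hA : MeasurableSet A) : posterior (wishart d b) X A ≤ 1 := by
  rw [posterior_wishart X hb hA]
  exact div_le_one_of_le₀ (ENNReal.toReal_mono (coneMeasure_univ_lt_top X hb).ne
    (measure_mono (Set.subset_univ _))) ENNReal.toReal_nonneg

theorem posterior_wishart_mono {n d : ℕ} (X : Sample n d) {b : ℤ} (hb : 1 ≤ b)
    {A B : Set (RMat d)} (hA : MeasurableSet A) (hB : MeasurableSet B) (h : A ⊆ B) :
    posterior (wishart d b) X A ≤ posterior (wishart d b) X B := by
  rw [posterior_wishart X hb hA, posterior_wishart X hb hB]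
  have hfin := (coneMeasure_univ_lt_top X hb).ne
  exact div_le_div_of_nonneg_right (ENNReal.toReal_mono
    (measure_ne_top_of_subset (Set.subset_univ _) hfin) (measure_mono h)) ENNReal.toReal_nonneg

theorem one_sub_le_posterior_wishart {n d : ℕ} (X : Sample n d) {b : ℤ} (hb : 1 ≤ b)
    {A : Set (RMat d)} (hA : MeasurableSet A) {τ : ℝ} (hτ : 0 ≤ τ)
    (h : coneMeasure (((n : ℝ) + b - 2) / 2) ((n : ℝ) • sampleCov X + 1) Aᶜ ≤ ENNReal.ofReal τ *
      coneMeasure (((n : ℝ) + b - 2) / 2) ((n : ℝ) • sampleCov X + 1) Set.univ) :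
    1 - τ ≤ posterior (wishart d b) X A := by
  have hfin := (coneMeasure_univ_lt_top X hb).ne
  have hpos := ENNReal.toReal_pos
    (coneMeasure_univ_pos (((n : ℝ) + b - 2) / 2) ((n : ℝ) • sampleCov X + 1)).ne' hfin
  rw [posterior_wishart X hb hA, le_div_iff₀ hpos]
  have hadd := measure_add_measure_compl (μ := coneMeasure (((n : ℝ) + b - 2) / 2)
    ((n : ℝ) • sampleCov X + 1)) hA
  have h1 := congrArg ENNReal.toReal hadd
  rw [ENNReal.toReal_add (measure_ne_top_of_subset (Set.subset_univ _) hfin)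
    (measure_ne_top_of_subset (Set.subset_univ _) hfin)] at h1
  have h2 := ENNReal.toReal_mono (ENNReal.mul_ne_top ENNReal.ofReal_ne_top hfin) h
  rw [ENNReal.toReal_mul, ENNReal.toReal_ofReal hτ] at h2
  linarith

/-! ### From spectral deviations to the covariance ball -/

theorem quadForm_of_norm_conj_sub_le {d : ℕ} {R M : RMat d} (hR : R.PosDef) {N c : ℝ}
    (h : ‖R * M * R - N • (1 : RMat d)‖ ≤ c) (w : Fin d → ℝ) :
    |w ⬝ᵥ M.mulVec w - N * (w ⬝ᵥ (R * R)⁻¹.mulVec w)| ≤ c * (w ⬝ᵥ (R * R)⁻¹.mulVec w) := by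
  set u := R⁻¹.mulVec w with hu
  have hRs : R.transpose = R := hR.isSymm_real
  have hRu : R.mulVec u = w := by
    rw [hu, Matrix.mulVec_mulVec, Matrix.mul_nonsing_inv _ hR.isUnit_det_real, Matrix.one_mulVec]
  have h1 : u ⬝ᵥ (R * M * R).mulVec u = w ⬝ᵥ M.mulVec w := by
    rw [← Matrix.mulVec_mulVec, hRu, ← Matrix.mulVec_mulVec, Matrix.dotProduct_mulVec,
      ← Matrix.mulVec_transpose, hRs, hRu]
  have h2 : w ⬝ᵥ (R * R)⁻¹.mulVec w = u ⬝ᵥ u := by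
    have hRi : (R⁻¹).transpose = R⁻¹ := hR.inv.isSymm_real
    rw [Matrix.mul_inv_rev, ← Matrix.mulVec_mulVec, Matrix.dotProduct_mulVec,
      ← Matrix.mulVec_transpose, hRi]
  have h3 := abs_quadForm_le (R * M * R - N • (1 : RMat d)) u
  rw [Matrix.sub_mulVec, dotProduct_sub, Matrix.smul_mulVec, Matrix.one_mulVec, dotProduct_smul,
    smul_eq_mul, h1] at h3
  rw [h2]
  refine h3.trans (mul_le_mul_of_nonneg_right h ?_)
  rw [← norm_toLp_sq]
  positivity

theorem dotProduct_self_le_norm_inv_mul {d : ℕ} {A : RMat d} (hA : A.PosDef) (u : Fin d → ℝ) :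
    u ⬝ᵥ u ≤ ‖A⁻¹‖ * (u ⬝ᵥ A.mulVec u) := by
  set R := CFC.sqrt A with hR
  have hRp : R.PosDef := hA.sqrt
  have hRR : R * R = A := hA.sqrt_mul_self
  have hRs : R.transpose = R := hRp.isSymm_real
  have h1 := (le_abs_self _).trans (abs_quadForm_le A⁻¹ (R.mulVec u))
  have h2 : R.mulVec u ⬝ᵥ R.mulVec u = u ⬝ᵥ A.mulVec u := by
    rw [← hRR, ← Matrix.mulVec_mulVec, Matrix.dotProduct_mulVec u, ← Matrix.mulVec_transpose, hRs]
  have h3 : R.mulVec u ⬝ᵥ A⁻¹.mulVec (R.mulVec u) = u ⬝ᵥ u := by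
    have e : R * A⁻¹ * R = 1 := by
      rw [← hRR, Matrix.mul_inv_rev, mul_assoc, mul_assoc, Matrix.nonsing_inv_mul _ hRp.isUnit_det_real,
        mul_one, Matrix.mul_nonsing_inv _ hRp.isUnit_det_real]
    rw [dotProduct_comm, Matrix.dotProduct_mulVec, ← Matrix.mulVec_transpose, hRs, dotProduct_comm,
      Matrix.mulVec_mulVec, Matrix.mulVec_mulVec, e, Matrix.one_mulVec]
  rwa [h2, h3] at h1

theorem mul_quadForm_inv_le {d : ℕ} {G Ω : RMat d} (hG : G.PosDef) (hΩ : Ω.PosDef) {c : ℝ}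
    (hc : 0 < c) (h : ∀ w : Fin d → ℝ, c * (w ⬝ᵥ G⁻¹.mulVec w) ≤ w ⬝ᵥ Ω.mulVec w)
    (u : Fin d → ℝ) : c * (u ⬝ᵥ Ω⁻¹.mulVec u) ≤ u ⬝ᵥ G.mulVec u := by
  have hinv : (c • G⁻¹)⁻¹ = c⁻¹ • G := by
    refine Matrix.inv_eq_right_inv ?_
    rw [Matrix.smul_mul, Matrix.mul_smul, smul_smul, mul_inv_cancel₀ hc.ne', one_smul,
      Matrix.nonsing_inv_mul _ hG.isUnit_det_real]
  have h1 := quadForm_inv_anti (hG.inv.smul hc) hΩ (fun w => by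
    rw [Matrix.smul_mulVec, dotProduct_smul, smul_eq_mul]
    exact h w) u
  rw [hinv, Matrix.smul_mulVec, dotProduct_smul, smul_eq_mul] at h1
  have := mul_le_mul_of_nonneg_left h1 hc.le
  rwa [← mul_assoc, mul_inv_cancel₀ hc.ne', one_mul] at this

theorem quadForm_le_mul_quadForm_inv {d : ℕ} {G Ω : RMat d} (hG : G.PosDef) (hΩ : Ω.PosDef) {c : ℝ}
    (hc : 0 < c) (h : ∀ w : Fin d → ℝ, w ⬝ᵥ Ω.mulVec w ≤ c * (w ⬝ᵥ G⁻¹.mulVec w))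
    (u : Fin d → ℝ) : u ⬝ᵥ G.mulVec u ≤ c * (u ⬝ᵥ Ω⁻¹.mulVec u) := by
  have hinv : (c • G⁻¹)⁻¹ = c⁻¹ • G := by
    refine Matrix.inv_eq_right_inv ?_
    rw [Matrix.smul_mul, Matrix.mul_smul, smul_smul, mul_inv_cancel₀ hc.ne', one_smul,
      Matrix.nonsing_inv_mul _ hG.isUnit_det_real]
  have h1 := quadForm_inv_anti hΩ (hG.inv.smul hc) (fun w => by
    rw [Matrix.smul_mulVec, dotProduct_smul, smul_eq_mul]
    exact h w) u
  rw [hinv, Matrix.smul_mulVec, dotProduct_smul, smul_eq_mul] at h1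
  have := mul_le_mul_of_nonneg_left h1 hc.le
  rwa [← mul_assoc, mul_inv_cancel₀ hc.ne', one_mul] at this

/-- If the sample covariance is relatively `η`-close to `S`, and `Ω` is relatively `η`-close to
`N (n Σ̂ + 1)⁻¹`, which is nearly `Σ̂⁻¹`, then `Ω⁻¹` is close to `S`. -/
theorem mem_covBall_of_norm_le {d : ℕ} {S M Ω : RMat d} (hS : S.PosDef) (hΩ : Ω.PosDef)
    (hM : (M + 1).PosDef) {n N K η : ℝ} (hn : 0 < n) (hnN : n ≤ N) (hN : N ≤ n * (1 + η))
    (hη0 : 0 < η) (hη1 : η ≤ 1 / 2) (hK : 0 ≤ K) (hSK : ‖S‖ ≤ K) (hSK' : ‖S⁻¹‖ ≤ K)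
    (hKn : K ≤ η * n)
    (h1 : ‖CFC.sqrt S⁻¹ * M * CFC.sqrt S⁻¹ - n • (1 : RMat d)‖ ≤ η * n)
    (h2 : ‖CFC.sqrt (M + 1) * Ω * CFC.sqrt (M + 1) - N • (1 : RMat d)‖ ≤ η * N) :
    Ω ∈ covBall S (6 * η * K) := by
  refine ⟨hΩ, norm_le_of_forall_abs_quadForm_le (hΩ.inv.isSymm_real.sub hS.isSymm_real)
    (by positivity) fun u => ?_⟩
  have hN0 : 0 < N := hn.trans_le hnN
  have a1 := quadForm_of_norm_conj_sub_le hS.inv.sqrt h1 u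
  rw [hS.inv.sqrt_mul_self, Matrix.nonsing_inv_nonsing_inv _ hS.isUnit_det_real] at a1
  have a2 := quadForm_of_norm_conj_sub_le hM.sqrt h2
  rw [hM.sqrt_mul_self] at a2
  set q := u ⬝ᵥ S.mulVec u
  set y := u ⬝ᵥ Ω⁻¹.mulVec u with hy
  have b1 : (1 - η) * N * y ≤ u ⬝ᵥ (M + 1).mulVec u :=
    mul_quadForm_inv_le hM hΩ (mul_pos (by linarith) hN0) (fun w => by
      have := (abs_le.1 (a2 w)).1
      linarith) u
  have b2 : u ⬝ᵥ (M + 1).mulVec u ≤ (1 + η) * N * y :=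
    quadForm_le_mul_quadForm_inv hM hΩ (mul_pos (by linarith) hN0) (fun w => by
      have := (abs_le.1 (a2 w)).2
      linarith) u
  have hq0 : 0 ≤ q := hS.dotProduct_nonneg u
  have hy0 : 0 ≤ y := hΩ.inv.dotProduct_nonneg u
  have huu : 0 ≤ u ⬝ᵥ u := by
    rw [← norm_toLp_sq]
    positivity
  have hqu : u ⬝ᵥ u ≤ K * q := (dotProduct_self_le_norm_inv_mul hS u).trans
    (mul_le_mul_of_nonneg_right hSK' hq0)
  have huq : q ≤ K * (u ⬝ᵥ u) := (le_abs_self _).trans ((abs_quadForm_le S u).trans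
    (mul_le_mul_of_nonneg_right hSK huu))
  rw [Matrix.add_mulVec, Matrix.one_mulVec, dotProduct_add] at b1 b2
  have hup : y ≤ (1 + 6 * η) * q := by
    have c1 : (1 - η) * n * y ≤ (1 - η) * N * y :=
      mul_le_mul_of_nonneg_right (mul_le_mul_of_nonneg_left hnN (by linarith)) hy0
    have c2 : u ⬝ᵥ M.mulVec u ≤ (1 + η) * n * q := by
      have := (abs_le.1 a1).2
      linarith
    have c3 : K * q ≤ η * n * q := mul_le_mul_of_nonneg_right hKn hq0
    have c4 : n * ((1 - η) * y) ≤ n * ((1 + 2 * η) * q) := by linarith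
    have c5 := le_of_mul_le_mul_left c4 hn
    have c6 : (1 + 2 * η) * q ≤ (1 - η) * ((1 + 6 * η) * q) := by
      have : 0 ≤ η * (1 - 2 * η) * q :=
        mul_nonneg (mul_nonneg hη0.le (by linarith)) hq0
      nlinarith
    exact le_of_mul_le_mul_left (c5.trans c6) (by linarith)
  have hlo : (1 - 6 * η) * q ≤ y := by
    have c1 : (1 + η) * N * y ≤ (1 + η) * (n * (1 + η)) * y :=
      mul_le_mul_of_nonneg_right (mul_le_mul_of_nonneg_left hN (by linarith)) hy0
    have c2 : (1 - η) * n * q ≤ u ⬝ᵥ M.mulVec u := by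
      have := (abs_le.1 a1).1
      linarith
    have c4 : n * ((1 - η) * q) ≤ n * ((1 + η) ^ 2 * y) := by nlinarith
    have c5 := le_of_mul_le_mul_left c4 hn
    by_contra! hcon
    have c6 : (1 + η) ^ 2 * y ≤ (1 + η) ^ 2 * ((1 - 6 * η) * q) :=
      mul_le_mul_of_nonneg_left hcon.le (by positivity)
    have c7 : (1 + η) ^ 2 * (1 - 6 * η) < 1 - η := by nlinarith [pow_pos hη0 2, pow_pos hη0 3]
    rcases hq0.eq_or_lt with h | h
    · rw [← h] at hcon
      linarith
    · have := mul_lt_mul_of_pos_right c7 h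
      linarith
  rw [Matrix.sub_mulVec, dotProduct_sub]
  have hf : 6 * η * q ≤ 6 * η * (K * (u ⬝ᵥ u)) := mul_le_mul_of_nonneg_left huq (by positivity)
  rw [abs_le]
  constructor <;> linarith

theorem lintegral_exp_quadForm_coneMeasure {d : ℕ} (a : ℝ) {G : RMat d} (hG : G.PosDef)
    {u : Fin d → ℝ} (hu : u ⬝ᵥ u = 1) {s : ℝ} (hs : 2 * s < 1) :
    ∫⁻ Ω, ENNReal.ofReal (Real.exp (s * (u ⬝ᵥ (CFC.sqrt G * Ω * CFC.sqrt G).mulVec u)))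
      ∂coneMeasure a G =
    ENNReal.ofReal (Real.exp (-((2 * a + d + 1) / 2) * Real.log (1 - 2 * s))) *
      coneMeasure a G Set.univ := by
  have hmgf := lintegral_exp_quadForm_coneWeight a hG.sqrt hu hs
  rw [hG.sqrt_mul_self] at hmgf
  have hm : Measurable fun Ω : RMat d => u ⬝ᵥ (CFC.sqrt G * Ω * CFC.sqrt G).mulVec u :=
    (Continuous.dotProduct continuous_const (Continuous.matrix_mulVec
      ((continuous_const.matrix_mul continuous_id).matrix_mul continuous_const)
      continuous_const)).measurable
  have hm2 : Measurable fun Ω : RMat d =>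
      ENNReal.ofReal (Real.exp (s * (u ⬝ᵥ (CFC.sqrt G * Ω * CFC.sqrt G).mulVec u))) :=
    (Real.measurable_exp.comp (hm.const_mul s)).ennreal_ofReal
  rw [coneMeasure_univ, ← hmgf, coneMeasure, lintegral_withDensity_eq_lintegral_mul _
    (measurable_coneWeight _ _) hm2]
  simp only [Pi.mul_apply, mul_comm]

/-- Deviation of a Wishart matrix, rescaled to the identity, in spectral norm. -/
theorem coneMeasure_norm_sub_gt_le {d : ℕ} {a N : ℝ} {G : RMat d} (hG : G.PosDef)
    (hNa : 2 * a + d + 1 = N) (hN : 0 ≤ N) {η : ℝ} (hη0 : 0 ≤ η) (hη1 : η ≤ 1) :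
    coneMeasure a G {Ω | (CFC.sqrt G * Ω * CFC.sqrt G).IsSymm ∧ η * N <
      ‖CFC.sqrt G * Ω * CFC.sqrt G - N • (1 : RMat d)‖} ≤
    ENNReal.ofReal (2 * 5 ^ d * Real.exp (-(N * η ^ 2 / 16384))) * coneMeasure a G Set.univ := by
  have hcont : ∀ u : Fin d → ℝ, Measurable fun Ω : RMat d =>
      u ⬝ᵥ (CFC.sqrt G * Ω * CFC.sqrt G).mulVec u := fun u =>
    (Continuous.dotProduct continuous_const (Continuous.matrix_mulVec
      ((continuous_const.matrix_mul continuous_id).matrix_mul continuous_const)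
      continuous_const)).measurable
  refine measure_norm_sub_gt_le _ _ hcont hN _ (fun u hu s hs => ?_) hη0 hη1
  have hs2 : 2 * s < 1 := by linarith [(abs_le.1 hs).2]
  rw [lintegral_exp_quadForm_coneMeasure a hG hu hs2, hNa]

theorem coneMeasure_compl_posDef {d : ℕ} (a : ℝ) (G : RMat d) :
    coneMeasure a G {Ω | Ω.PosDef}ᶜ = 0 := by
  rw [coneMeasure, withDensity_apply _ (measurableSet_posDef d).compl]
  refine (setLIntegral_congr_fun (measurableSet_posDef d).compl fun Ω hΩ => ?_).trans
    (lintegral_zero)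
  rw [coneWeight, Set.indicator_of_notMem hΩ]

/-- Posterior concentration on the event that the sample covariance is close to `S`. -/
theorem one_sub_le_posterior_covBall {n d : ℕ} (X : Sample n d) {b : ℤ} (hb : 1 ≤ b) {S : RMat d}
    (hS : S.PosDef) {K η : ℝ} (hn : 0 < n) (hη0 : 0 < η) (hη1 : η ≤ 1 / 2) (hK : 0 ≤ K)
    (hSK : ‖S‖ ≤ K) (hSK' : ‖S⁻¹‖ ≤ K) (hKn : K ≤ η * n) (hbn : (b : ℝ) + d ≤ η * n)
    (hX : ‖CFC.sqrt S⁻¹ * ((n : ℝ) • sampleCov X) * CFC.sqrt S⁻¹ - (n : ℝ) • (1 : RMat d)‖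
      ≤ η * n) :
    1 - 2 * 5 ^ d * Real.exp (-(n * η ^ 2 / 16384)) ≤
      posterior (wishart d b) X (covBall S (6 * η * K)) := by
  have hn' : (0 : ℝ) < n := by exact_mod_cast hn
  have hb' : (1 : ℝ) ≤ b := by exact_mod_cast hb
  have hd' : (0 : ℝ) ≤ d := Nat.cast_nonneg d
  refine one_sub_le_posterior_wishart X hb (measurableSet_covBall _ _) (by positivity) ?_
  obtain ⟨G, hGdef⟩ : ∃ G, G = (n : ℝ) • sampleCov X + 1 := ⟨_, rfl⟩
  have hG : G.PosDef := hGdef ▸ posDef_smul_sampleCov_add_one X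
  obtain ⟨N, hNn⟩ : ∃ N : ℝ, N = n + (b + d - 1) := ⟨_, rfl⟩
  have hNa : 2 * (((n : ℝ) + b - 2) / 2) + d + 1 = N := by
    rw [hNn]
    ring
  have hdev := coneMeasure_norm_sub_gt_le hG hNa (by rw [hNn]; linarith) hη0.le (by linarith)
  have hsub : (covBall S (6 * η * K))ᶜ ⊆ {Ω | Ω.PosDef}ᶜ ∪
      {Ω | (CFC.sqrt G * Ω * CFC.sqrt G).IsSymm ∧
        η * N < ‖CFC.sqrt G * Ω * CFC.sqrt G - N • (1 : RMat d)‖} := by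
    intro Ω hΩ
    by_cases hP : Ω.PosDef
    · right
      refine ⟨?_, ?_⟩
      · rw [Matrix.IsSymm, Matrix.transpose_mul, Matrix.transpose_mul, hG.sqrt.isSymm_real.eq,
          hP.isSymm_real.eq, mul_assoc]
      · by_contra! hcon
        rw [hGdef] at hcon hG
        exact hΩ (mem_covBall_of_norm_le hS hP hG hn' (by rw [hNn]; linarith)
          (by rw [hNn]; linarith) hη0 hη1 hK hSK hSK' hKn hX hcon)
    · exact Or.inl hP
  rw [← hGdef]
  refine (measure_mono hsub).trans ((measure_union_le _ _).trans ?_)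
  rw [coneMeasure_compl_posDef, zero_add]
  refine hdev.trans (mul_le_mul_left (ENNReal.ofReal_le_ofReal ?_) _)
  refine mul_le_mul_of_nonneg_left (Real.exp_le_exp.2 ?_) (by positivity)
  have : (n : ℝ) * η ^ 2 ≤ N * η ^ 2 :=
    mul_le_mul_of_nonneg_right (by rw [hNn]; linarith) (sq_nonneg η)
  linarith

/-- Deviation of the sample covariance in spectral norm. -/
theorem sampleLaw_norm_sub_gt_le {n d : ℕ} (hn : 0 < n) {S : RMat d} (hS : S.PosDef) {η : ℝ}
    (hη0 : 0 ≤ η) (hη1 : η ≤ 1) :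
    sampleLaw n S {X | η * n < ‖CFC.sqrt S⁻¹ * ((n : ℝ) • sampleCov X) * CFC.sqrt S⁻¹
      - (n : ℝ) • (1 : RMat d)‖}
      ≤ ENNReal.ofReal (2 * 5 ^ d * Real.exp (-(n * η ^ 2 / 16384))) := by
  set R := CFC.sqrt S⁻¹ with hR
  have hRp : R.PosDef := hS.inv.sqrt
  have hRR : R * R = S⁻¹ := hS.inv.sqrt_mul_self
  have hRs : R.transpose = R := hRp.isSymm_real
  have hq : ∀ (X : Sample n d) (u : Fin d → ℝ), u ⬝ᵥ (R * ((n : ℝ) • sampleCov X) * R).mulVec u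
      = R.mulVec u ⬝ᵥ ((n : ℝ) • sampleCov X).mulVec (R.mulVec u) := by
    intro X u
    rw [← Matrix.mulVec_mulVec, ← Matrix.mulVec_mulVec, Matrix.dotProduct_mulVec u,
      ← Matrix.mulVec_transpose, hRs]
  have hsymm : ∀ X : Sample n d, (R * ((n : ℝ) • sampleCov X) * R).IsSymm := by
    intro X
    have h : (sampleCov X).IsSymm := by
      ext i j
      simp [sampleCov, Matrix.sum_apply, Matrix.vecMulVec_apply, mul_comm]
    rw [Matrix.IsSymm, Matrix.transpose_mul, Matrix.transpose_mul, hRs, (h.smul _).eq, mul_assoc]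
  have hdev := measure_norm_sub_gt_le (sampleLaw n S)
    (fun X => R * ((n : ℝ) • sampleCov X) * R) (fun u => by
      simp only [hq, quadForm_sampleCov hn.ne']
      have : Continuous fun X : Sample n d => ∑ i, (R.mulVec u ⬝ᵥ (X i).ofLp) ^ 2 := by
        refine continuous_finsetSum _ fun i _ => Continuous.pow ?_ 2
        exact Continuous.dotProduct continuous_const
          ((PiLp.continuous_ofLp 2 _).comp (continuous_apply i))
      exact this.measurable) (N := n) (Nat.cast_nonneg n) 1 (fun u hu s hs => by
      have hs2 : 2 * s < 1 := by linarith [(abs_le.1 hs).2]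
      simp only [hq]
      rw [mul_one, lintegral_exp_quadForm_sampleCov hn.ne' hS _ hs2]
      have hRSR : R * S * R = 1 := by
        have : S = (R * R)⁻¹ := by
          rw [hRR, Matrix.nonsing_inv_nonsing_inv _ hS.isUnit_det_real]
        rw [this, Matrix.mul_inv_rev, mul_assoc, mul_assoc, Matrix.nonsing_inv_mul _ hRp.isUnit_det_real,
          mul_one, Matrix.mul_nonsing_inv _ hRp.isUnit_det_real]
      rw [dotProduct_comm, Matrix.dotProduct_mulVec, ← Matrix.mulVec_transpose, hRs,
        dotProduct_comm, Matrix.mulVec_mulVec, Matrix.mulVec_mulVec, hRSR, Matrix.one_mulVec, hu])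
    hη0 hη1
  rw [mul_one] at hdev
  refine (measure_mono ?_).trans hdev
  exact fun X hX => ⟨hsymm X, hX⟩

/-! ### Small shifts of the precision matrix -/

theorem frobNorm_neg {d : ℕ} (A : RMat d) : frobNorm (-A) = frobNorm A := by
  unfold frobNorm
  simp

theorem lintegral_symLebesgue_add {d : ℕ} {D : RMat d} (hD : D.IsSymm) {g : RMat d → ENNReal}
    (hg : Measurable g) : ∫⁻ Ω, g (Ω + D) ∂symLebesgue d = ∫⁻ Ω, g Ω ∂symLebesgue d := by
  have hadd : Measurable fun Ω : RMat d => g (Ω + D) :=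
    hg.comp (continuous_id.add continuous_const).measurable
  rw [symLebesgue, lintegral_map hadd measurable_symMatrix, lintegral_map hg measurable_symMatrix]
  set y : Sym2 (Fin d) → ℝ := fun z => Sym2.lift ⟨fun i j => D i j, fun i j => hD.apply j i⟩ z
  have hy : ∀ x, symMatrix x + D = symMatrix (x + y) := by
    intro x
    ext i j
    simp [symMatrix, y]
  simp only [hy]
  exact lintegral_add_right_eq_self (fun x => g (symMatrix x)) y

/-- Precision matrices in a covariance ball stay positive definite, with controlled inverse, under
small perturbations. -/
theorem add_posDef_of_mem_covBall {d : ℕ} {S Ω D : RMat d} {K ρ δ : ℝ} (hK : 0 < K) (hSK : ‖S‖ ≤ K)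
    (hρ : ρ ≤ K) (hΩ : Ω ∈ covBall S ρ) (hD : D.IsSymm) (hDδ : ‖D‖ ≤ δ) (hδ : δ ≤ 1 / (4 * K)) :
    (Ω + D).PosDef ∧ ‖Ω⁻¹‖ ≤ 2 * K ∧ ‖(Ω + D)⁻¹‖ ≤ 4 * K ∧
      ‖(Ω + D)⁻¹ - Ω⁻¹‖ ≤ 8 * K ^ 2 * δ := by
  obtain ⟨hP, hball⟩ := hΩ
  have hinv : ‖Ω⁻¹‖ ≤ 2 * K := by
    have : Ω⁻¹ = (Ω⁻¹ - S) + S := by abel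
    rw [this]
    refine (norm_add_le _ _).trans ?_
    linarith
  have hform : ∀ u : Fin d → ℝ, 1 / (4 * K) * (u ⬝ᵥ u) ≤ u ⬝ᵥ (Ω + D).mulVec u := by
    intro u
    have huu : 0 ≤ u ⬝ᵥ u := by
      rw [← norm_toLp_sq]
      positivity
    have h1 := (dotProduct_self_le_norm_inv_mul hP u).trans
      (mul_le_mul_of_nonneg_right hinv (hP.dotProduct_nonneg u))
    have h2 := (abs_le.1 ((abs_quadForm_le D u).trans
      (mul_le_mul_of_nonneg_right (hDδ.trans hδ) huu))).1
    have h3 := mul_le_mul_of_nonneg_left h1 (by positivity : 0 ≤ 1 / (2 * K))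
    have h4 : 1 / (2 * K) * (2 * K * (u ⬝ᵥ Ω.mulVec u)) = u ⬝ᵥ Ω.mulVec u := by field_simp
    have h5 : 1 / (2 * K) * (u ⬝ᵥ u) = 2 * (1 / (4 * K) * (u ⬝ᵥ u)) := by
      field_simp
      ring
    rw [Matrix.add_mulVec, dotProduct_add]
    linarith
  have hsymm : (Ω + D).IsSymm := hP.isSymm_real.add hD
  have hPD : (Ω + D).PosDef := by
    rw [posDef_iff_forall_dotProduct]
    refine ⟨hsymm, fun x hx => lt_of_lt_of_le ?_ (hform x)⟩
    have h2 : 0 < x ⬝ᵥ x := by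
      rw [← norm_toLp_sq]
      have : 0 < ‖WithLp.toLp 2 x‖ := by
        rw [norm_pos_iff]
        simpa using hx
      positivity
    positivity
  have hinv' : ‖(Ω + D)⁻¹‖ ≤ 4 * K := by
    refine norm_le_of_forall_abs_quadForm_le hPD.inv.isSymm_real (by positivity) fun u => ?_
    rw [abs_of_nonneg (hPD.inv.dotProduct_nonneg u)]
    have h := mul_quadForm_inv_le (G := 1) Matrix.PosDef.one hPD (c := 1 / (4 * K)) (by positivity)
      (fun w => by
        rw [inv_one, Matrix.one_mulVec]
        exact hform w) u
    rw [Matrix.one_mulVec] at h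
    have h2 := mul_le_mul_of_nonneg_left h (by positivity : 0 ≤ 4 * K)
    have h3 : 4 * K * (1 / (4 * K) * (u ⬝ᵥ (Ω + D)⁻¹.mulVec u)) = u ⬝ᵥ (Ω + D)⁻¹.mulVec u := by
      field_simp
    linarith
  refine ⟨hPD, hinv, hinv', ?_⟩
  have hres : (Ω + D)⁻¹ - Ω⁻¹ = -((Ω + D)⁻¹ * D * Ω⁻¹) := by
    have e1 : (Ω + D)⁻¹ * (Ω + D) * Ω⁻¹ = Ω⁻¹ := by
      rw [Matrix.nonsing_inv_mul _ hPD.isUnit_det_real, one_mul]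
    have e2 : (Ω + D)⁻¹ * Ω * Ω⁻¹ = (Ω + D)⁻¹ := by
      rw [mul_assoc, Matrix.mul_nonsing_inv _ hP.isUnit_det_real, mul_one]
    rw [mul_add, add_mul, e2] at e1
    rw [sub_eq_iff_eq_add, neg_add_eq_sub]
    exact eq_sub_of_add_eq e1
  rw [hres, norm_neg]
  have hδ0 : 0 ≤ δ := (norm_nonneg _).trans hDδ
  calc ‖(Ω + D)⁻¹ * D * Ω⁻¹‖ ≤ ‖(Ω + D)⁻¹‖ * ‖D‖ * ‖Ω⁻¹‖ :=
        (norm_mul_le _ _).trans (mul_le_mul_of_nonneg_right (norm_mul_le _ _) (norm_nonneg _))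
    _ ≤ (4 * K) * δ * (2 * K) := by gcongr
    _ = _ := by ring

/-- The prior density changes by a factor close to `1` under a small shift. -/
theorem coneWeight_shift_le {d : ℕ} {Ω D : RMat d} {β B K δ : ℝ} (hΩ : Ω.PosDef)
    (hΩD : (Ω + D).PosDef) (hβ : |β| ≤ B) (h1 : ‖Ω⁻¹‖ ≤ 4 * K) (h2 : ‖(Ω + D)⁻¹‖ ≤ 4 * K)
    (hDδ : frobNorm D ≤ δ) :
    coneWeight β 1 Ω ≤ ENNReal.ofReal (Real.exp (Real.sqrt d * δ * (4 * K * B + 1))) *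
      coneWeight β 1 (Ω + D) ∧
    coneWeight β 1 (Ω + D) ≤ ENNReal.ofReal (Real.exp (Real.sqrt d * δ * (4 * K * B + 1))) *
      coneWeight β 1 Ω := by
  have hδ0 : 0 ≤ δ := (frobNorm_nonneg _).trans hDδ
  have hK0 : 0 ≤ 4 * K := (norm_nonneg _).trans h1
  have hs := Real.sqrt_nonneg (d : ℝ)
  have hF := frobNorm_nonneg D
  have l1 : Real.log (Ω + D).det - Real.log Ω.det ≤ Real.sqrt d * (4 * K) * δ :=
    (log_det_add_sub_le hΩ hΩD).trans (by gcongr)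
  have l2 : Real.log Ω.det - Real.log (Ω + D).det ≤ Real.sqrt d * (4 * K) * δ := by
    have h := log_det_add_sub_le (A := Ω + D) (D := -D) hΩD (by simpa using hΩ)
    rw [add_neg_cancel_right, frobNorm_neg] at h
    exact h.trans (by gcongr)
  have hlog : |β * (Real.log (Ω + D).det - Real.log Ω.det)| ≤ B * (Real.sqrt d * (4 * K) * δ) := by
    rw [abs_mul]
    exact mul_le_mul hβ (abs_le.2 ⟨by linarith, l1⟩) (abs_nonneg _) ((abs_nonneg _).trans hβ)
  have htr : |D.trace| ≤ Real.sqrt d * δ := by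
    have h := abs_trace_mul_le 1 D
    rw [one_mul, frobNorm_one] at h
    exact h.trans (by gcongr)
  have ht0 : 0 ≤ Real.sqrt d * δ := mul_nonneg hs hδ0
  obtain ⟨a1, a2⟩ := abs_le.1 hlog
  obtain ⟨b1, b2⟩ := abs_le.1 htr
  have hexp : Real.sqrt d * δ * (4 * K * B + 1)
      = B * (Real.sqrt d * (4 * K) * δ) + Real.sqrt d * δ := by ring
  simp only [coneWeight]
  rw [Set.indicator_of_mem (by exact hΩ), Set.indicator_of_mem (by exact hΩD),
    ← ENNReal.ofReal_mul (Real.exp_nonneg _), ← Real.exp_add,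
    ← ENNReal.ofReal_mul (Real.exp_nonneg _), ← Real.exp_add, mul_one, mul_one, Matrix.trace_add,
    hexp]
  constructor <;> refine ENNReal.ofReal_le_ofReal (Real.exp_le_exp.2 ?_) <;> linarith

/-- The numerator of the shift ratio, compared with posterior masses: shifting the posterior
density is the same as shifting the covariance ball, up to the variation of the prior density. -/
theorem lintegral_shift_bounds {n d : ℕ} (X : Sample n d) (b : ℤ) {S D : RMat d}
    {K B ρ δ : ℝ} (hK : 0 < K) (hSK : ‖S‖ ≤ K) (hρ : ρ ≤ K) (hD : D.IsSymm)
    (hDδ : frobNorm D ≤ δ) (hδ : δ ≤ 1 / (4 * K)) (hδρ : 8 * K ^ 2 * δ ≤ ρ / 2)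
    (hβ : |((b : ℝ) - 2) / 2| ≤ B) :
    (∫⁻ Ω in covBall S ρ, ENNReal.ofReal (Real.exp (logLik X (Ω + D))) *
      coneWeight (((b : ℝ) - 2) / 2) 1 Ω ∂symLebesgue d) ≤
        ENNReal.ofReal (Real.exp (Real.sqrt d * δ * (4 * K * B + 1))) *
        coneMeasure (((n : ℝ) + b - 2) / 2) ((n : ℝ) • sampleCov X + 1) Set.univ ∧
    coneMeasure (((n : ℝ) + b - 2) / 2) ((n : ℝ) • sampleCov X + 1) (covBall S (ρ / 2)) ≤
      ENNReal.ofReal (Real.exp (Real.sqrt d * δ * (4 * K * B + 1))) *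
      ∫⁻ Ω in covBall S ρ, ENNReal.ofReal (Real.exp (logLik X (Ω + D))) *
      coneWeight (((b : ℝ) - 2) / 2) 1 Ω ∂symLebesgue d := by
  have hδ0 : 0 ≤ δ := (frobNorm_nonneg _).trans hDδ
  set β := ((b : ℝ) - 2) / 2
  set a := ((n : ℝ) + b - 2) / 2
  set G := (n : ℝ) • sampleCov X + 1
  set E := ENNReal.ofReal (Real.exp (Real.sqrt d * δ * (4 * K * B + 1)))
  have hcmp : ∀ Ω ∈ covBall S ρ,
      coneWeight β 1 Ω ≤ E * coneWeight β 1 (Ω + D) ∧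
      coneWeight β 1 (Ω + D) ≤ E * coneWeight β 1 Ω := by
    intro Ω hΩ
    obtain ⟨h1, h2, h3, -⟩ := add_posDef_of_mem_covBall hK hSK hρ hΩ hD
      ((norm_le_frobNorm D).trans hDδ) hδ
    exact coneWeight_shift_le hΩ.1 h1 hβ (h2.trans (by linarith)) h3 hDδ
  have hmG : Measurable (coneWeight a G) := measurable_coneWeight a G
  have hmD : Measurable fun Ω : RMat d => coneWeight a G (Ω + D) :=
    hmG.comp (continuous_id.add continuous_const).measurable
  constructor
  · calc (∫⁻ Ω in covBall S ρ, ENNReal.ofReal (Real.exp (logLik X (Ω + D))) *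
          coneWeight β 1 Ω ∂symLebesgue d)
        ≤ ∫⁻ Ω in covBall S ρ, E * coneWeight a G (Ω + D) ∂symLebesgue d := by
          refine setLIntegral_mono (hmD.const_mul E) fun Ω hΩ => ?_
          rw [← exp_logLik_mul_coneWeight X b (Ω + D), mul_left_comm]
          exact mul_le_mul_right (hcmp Ω hΩ).1 _
      _ ≤ ∫⁻ Ω, E * coneWeight a G (Ω + D) ∂symLebesgue d := setLIntegral_le_lintegral _ _
      _ = E * coneMeasure a G Set.univ := by
          rw [lintegral_const_mul _ hmD, lintegral_symLebesgue_add hD hmG, coneMeasure_univ]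
          rfl
  · have hsub : ∀ Ω : RMat d, Ω + D ∈ covBall S (ρ / 2) → Ω ∈ covBall S ρ := by
      intro Ω hΩ
      have hρ2 : ρ / 2 ≤ K := by
        rcases le_total 0 ρ with h | h <;> linarith
      obtain ⟨h1, -, -, h4⟩ := add_posDef_of_mem_covBall hK hSK hρ2 hΩ hD.neg
        ((norm_le_frobNorm (-D)).trans (by rwa [frobNorm_neg])) hδ
      rw [add_neg_cancel_right] at h1 h4
      refine ⟨h1, ?_⟩
      have : Ω⁻¹ - S = (Ω⁻¹ - (Ω + D)⁻¹) + ((Ω + D)⁻¹ - S) := by abel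
      rw [this]
      refine (norm_add_le _ _).trans ?_
      have := hΩ.2
      linarith
    have hA' := measurableSet_covBall S (ρ / 2)
    have hA := measurableSet_covBall S ρ
    have hmA : Measurable ((covBall S (ρ / 2)).indicator (coneWeight a G)) := hmG.indicator hA'
    have hmL : Measurable fun Ω : RMat d => ENNReal.ofReal (Real.exp (logLik X (Ω + D))) *
        coneWeight β 1 Ω :=
      ((Real.measurable_exp.comp ((measurable_logLik X).comp
        (continuous_id.add continuous_const).measurable)).ennreal_ofReal).mul
        (measurable_coneWeight β 1)
    calc coneMeasure a G (covBall S (ρ / 2))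
        = ∫⁻ Ω, (covBall S (ρ / 2)).indicator (coneWeight a G) (Ω + D) ∂symLebesgue d := by
          rw [lintegral_symLebesgue_add hD hmA, lintegral_indicator hA', coneMeasure,
            withDensity_apply _ hA']
      _ ≤ ∫⁻ Ω, (covBall S ρ).indicator (fun Ω => E *
            (ENNReal.ofReal (Real.exp (logLik X (Ω + D))) * coneWeight β 1 Ω)) Ω
            ∂symLebesgue d := by
          refine lintegral_mono fun Ω => ?_
          by_cases h : Ω + D ∈ covBall S (ρ / 2)
          · rw [Set.indicator_of_mem h, Set.indicator_of_mem (hsub Ω h),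
              ← exp_logLik_mul_coneWeight X b (Ω + D), mul_left_comm]
            exact mul_le_mul_right (hcmp Ω (hsub Ω h)).2 _
          · rw [Set.indicator_of_notMem h]
            exact zero_le
      _ = _ := by
          rw [lintegral_indicator hA, lintegral_const_mul _ hmL]

/-- The shift ratio lies between posterior probabilities of covariance balls. -/
theorem shiftRatio_wishart_bounds {n d : ℕ} (X : Sample n d) {b : ℤ} (hb : 1 ≤ b) {S D : RMat d}
    {K B ρ δ : ℝ} (hK : 0 < K) (hSK : ‖S‖ ≤ K) (hρ : ρ ≤ K) (hD : D.IsSymm)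
    (hDδ : frobNorm D ≤ δ) (hδ : δ ≤ 1 / (4 * K)) (hδρ : 8 * K ^ 2 * δ ≤ ρ / 2)
    (hβ : |((b : ℝ) - 2) / 2| ≤ B) (hpos : 0 < posterior (wishart d b) X (covBall S ρ)) :
    Real.exp (-(Real.sqrt d * δ * (4 * K * B + 1))) * posterior (wishart d b) X (covBall S (ρ / 2))
      ≤ shiftRatio (wishart d b) X (covBall S ρ) D ∧
    shiftRatio (wishart d b) X (covBall S ρ) D ≤
      Real.exp (Real.sqrt d * δ * (4 * K * B + 1)) / posterior (wishart d b) X (covBall S ρ) := by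
  obtain ⟨hup, hlo⟩ := lintegral_shift_bounds X b hK hSK hρ hD hDδ hδ hδρ hβ
  have hA := measurableSet_covBall S ρ
  have hA' := measurableSet_covBall S (ρ / 2)
  have hfin := (coneMeasure_univ_lt_top X hb).ne
  set ε := Real.sqrt d * δ * (4 * K * B + 1)
  have hmL : Measurable fun Ω : RMat d => Real.exp (logLik X (Ω + D)) :=
    Real.measurable_exp.comp ((measurable_logLik X).comp
      (continuous_id.add continuous_const).measurable)
  rw [posterior_wishart X hb hA] at hpos ⊢
  rw [posterior_wishart X hb hA', shiftRatio, setIntegral_exp_logLik X b hA,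
    setIntegral_wishart b hA hmL (fun Ω => Real.exp_nonneg _), ENNReal.toReal_mul,
    mul_div_mul_left _ _ (wishartConst_toReal_pos hb).ne']
  set I := ∫⁻ Ω in covBall S ρ, ENNReal.ofReal (Real.exp (logLik X (Ω + D))) *
      coneWeight (((b : ℝ) - 2) / 2) 1 Ω ∂symLebesgue d
  set ν := coneMeasure (((n : ℝ) + b - 2) / 2) ((n : ℝ) • sampleCov X + 1)
  have hU : 0 < (ν Set.univ).toReal := ENNReal.toReal_pos (coneMeasure_univ_pos _ _).ne' hfin
  have hAU : (ν (covBall S ρ)).toReal ≤ (ν Set.univ).toReal :=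
    ENNReal.toReal_mono hfin (measure_mono (Set.subset_univ _))
  have hA0 : 0 < (ν (covBall S ρ)).toReal := by
    by_contra! h
    exact absurd hpos (not_lt.2 (div_nonpos_of_nonpos_of_nonneg h hU.le))
  have hI : I ≠ ⊤ := ne_top_of_le_ne_top (ENNReal.mul_ne_top ENNReal.ofReal_ne_top hfin) hup
  have hup' := ENNReal.toReal_mono (ENNReal.mul_ne_top ENNReal.ofReal_ne_top hfin) hup
  have hlo' := ENNReal.toReal_mono (ENNReal.mul_ne_top ENNReal.ofReal_ne_top hI) hlo
  rw [ENNReal.toReal_mul, ENNReal.toReal_ofReal (Real.exp_nonneg _)] at hup' hlo'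
  constructor
  · have h1 : Real.exp (-ε) * (ν (covBall S (ρ / 2))).toReal ≤ I.toReal := by
      have := mul_le_mul_of_nonneg_left hlo' (Real.exp_nonneg (-ε))
      rwa [← mul_assoc, ← Real.exp_add, neg_add_cancel, Real.exp_zero, one_mul] at this
    rw [← mul_div_assoc]
    exact div_le_div₀ ENNReal.toReal_nonneg h1 hA0 hAU
  · rw [div_div_eq_mul_div]
    exact div_le_div_of_nonneg_right hup' hA0.le

/-! ### Asymptotics -/

theorem TendstoInSampleProb.of_bounds {p : ℕ → ℕ} {S : ∀ n, RMat (p n)}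
    {Y : ∀ n, Sample n (p n) → ℝ} {c : ℝ} (E : ∀ n, Set (Sample n (p n)))
    (hE : Tendsto (fun n => sampleLaw n (S n) (E n)ᶜ) atTop (𝓝 0)) {lo hi : ℕ → ℝ}
    (hlo : Tendsto lo atTop (𝓝 c)) (hhi : Tendsto hi atTop (𝓝 c))
    (h : ∀ᶠ n in atTop, ∀ X ∈ E n, lo n ≤ Y n X ∧ Y n X ≤ hi n) :
    TendstoInSampleProb p S Y c := by
  intro ε hε
  refine tendsto_of_tendsto_of_tendsto_of_le_of_le' tendsto_const_nhds hE
    (Eventually.of_forall fun n => zero_le) ?_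
  filter_upwards [h, hlo.eventually (lt_mem_nhds (by linarith : c - ε < c)),
    hhi.eventually (gt_mem_nhds (by linarith : c < c + ε))] with n hn h1 h2
  refine measure_mono fun X hX hXE => ?_
  obtain ⟨h3, h4⟩ := hn X hXE
  have h5 : |Y n X - c| < ε := abs_lt.2 ⟨by linarith, by linarith⟩
  exact absurd hX (not_le.2 h5)

/-- The radii for which concentration and shift invariance are established: they tend to zero, are
of larger order than `n ^ (-1/2)`, and at least a fixed multiple of `√(p / n)`. -/
structure AdmissibleRadius (p : ℕ → ℕ) (L : ℝ) (ρ : ℕ → ℝ) : Prop where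
  nonneg : ∀ n, 0 ≤ ρ n
  tendsto_zero : Tendsto ρ atTop (𝓝 0)
  tendsto_atTop : Tendsto (fun n : ℕ => (n : ℝ) * ρ n ^ 2) atTop atTop
  le_mul_sq : ∀ᶠ n : ℕ in atTop, L * p n ≤ n * ρ n ^ 2

theorem AdmissibleRadius.eventually_pos {p : ℕ → ℕ} {L : ℝ} {ρ : ℕ → ℝ}
    (h : AdmissibleRadius p L ρ) : ∀ᶠ n in atTop, 0 < ρ n := by
  filter_upwards [h.tendsto_atTop.eventually_gt_atTop 0] with n hn
  refine (h.nonneg n).lt_of_ne fun h0 => ?_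
  rw [← h0] at hn
  simp at hn

theorem five_pow_mul_exp_le {d : ℕ} {x : ℝ} (h : 4 * d ≤ x) :
    2 * 5 ^ d * Real.exp (-x) ≤ 2 * Real.exp (-(x / 2)) := by
  have h5 : (5 : ℝ) ≤ Real.exp 2 := by
    have h1 := Real.exp_one_gt_d9
    have h2 : Real.exp 2 = Real.exp 1 * Real.exp 1 := by
      rw [← Real.exp_add]
      norm_num
    rw [h2]
    nlinarith
  have h6 : (5 : ℝ) ^ d ≤ Real.exp (2 * d) := by
    rw [mul_comm, Real.exp_nat_mul]
    exact pow_le_pow_left₀ (by norm_num) h5 d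
  have h7 : (5 : ℝ) ^ d * Real.exp (-x) ≤ Real.exp (-(x / 2)) := by
    refine (mul_le_mul_of_nonneg_right h6 (Real.exp_nonneg _)).trans ?_
    rw [← Real.exp_add]
    refine Real.exp_le_exp.2 ?_
    linarith
  linarith

/-- On events of probability tending to one, the posterior mass of the covariance balls of radius
`ρ n / 2` is at least `1 - τ n`, with `τ n` tending to zero. The constant in `AdmissibleRadius`
makes the Chernoff exponent `n * η ^ 2 / 16384`, at `η = ρ / (12 K)`, beat the entropy `p log 5`
of the net of the sphere. -/
theorem exists_posterior_covBall_bound {p : ℕ → ℕ} (hp : ∀ n, 0 < p n) {S : ∀ n, RMat (p n)}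
    (hS : ∀ n, (S n).PosDef) {b : ℕ → ℤ} (hb : ∀ n, 1 ≤ b n) {K B : ℝ} (hK : 1 ≤ K)
    (hSK : ∀ᶠ n in atTop, ‖S n‖ ≤ K ∧ ‖(S n)⁻¹‖ ≤ K) (hB : 1 ≤ B)
    (hbB : ∀ᶠ n in atTop, (b n : ℝ) ≤ B) {ρ : ℕ → ℝ}
    (hρ : AdmissibleRadius p (9437184 * K ^ 2) ρ) :
    ∃ (E : ∀ n, Set (Sample n (p n))) (τ : ℕ → ℝ), Tendsto τ atTop (𝓝 0) ∧
      Tendsto (fun n => sampleLaw n (S n) (E n)ᶜ) atTop (𝓝 0) ∧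
      ∀ᶠ n in atTop, ∀ X ∈ E n,
        1 - τ n ≤ posterior (wishart (p n) (b n)) X (covBall (S n) (ρ n / 2)) := by
  have hK0 : 0 < K := by linarith
  set η : ℕ → ℝ := fun n => ρ n / (12 * K) with hη
  set τ : ℕ → ℝ := fun n => 2 * Real.exp (-((n : ℝ) * η n ^ 2 / 16384 / 2)) with hτ
  have hτ0 : Tendsto τ atTop (𝓝 0) := by
    have h1 : Tendsto (fun n : ℕ => (n : ℝ) * η n ^ 2 / 16384 / 2) atTop atTop := by
      have : (fun n : ℕ => (n : ℝ) * η n ^ 2 / 16384 / 2)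
          = fun n : ℕ => (n : ℝ) * ρ n ^ 2 * (1 / (144 * K ^ 2 * 32768)) := by
        funext n
        simp only [hη]
        field_simp
        ring
      rw [this]
      exact hρ.tendsto_atTop.atTop_mul_const (by positivity)
    have h2 := (Real.tendsto_exp_neg_atTop_nhds_zero.comp h1).const_mul 2
    rw [mul_zero] at h2
    exact h2
  refine ⟨fun n => {X | ‖CFC.sqrt (S n)⁻¹ * ((n : ℝ) • sampleCov X) * CFC.sqrt (S n)⁻¹
      - (n : ℝ) • (1 : RMat (p n))‖ ≤ η n * n}, τ, hτ0, ?_, ?_⟩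
  all_goals
    have hη1 : ∀ᶠ n in atTop, η n ≤ 1 / 2 := by
      have : Tendsto η atTop (𝓝 0) := by
        have h := hρ.tendsto_zero.div_const (12 * K)
        rwa [zero_div] at h
      filter_upwards [this.eventually (gt_mem_nhds (by norm_num : (0 : ℝ) < 1 / 2))] with n hn
      exact hn.le
    have hexp : ∀ᶠ n : ℕ in atTop,
        2 * 5 ^ p n * Real.exp (-((n : ℝ) * η n ^ 2 / 16384)) ≤ τ n := by
      filter_upwards [hρ.le_mul_sq] with n hn
      refine five_pow_mul_exp_le ?_
      simp only [hη]
      rw [div_pow, le_div_iff₀ (by norm_num), ← mul_div_assoc, le_div_iff₀ (by positivity)]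
      linarith
  · have hlim : Tendsto (fun n => ENNReal.ofReal (τ n)) atTop (𝓝 0) := by
      have := (ENNReal.continuous_ofReal.tendsto 0).comp hτ0
      rwa [ENNReal.ofReal_zero] at this
    refine tendsto_of_tendsto_of_tendsto_of_le_of_le' tendsto_const_nhds hlim
      (Eventually.of_forall fun n => zero_le) ?_
    filter_upwards [hη1, hexp, eventually_gt_atTop 0] with n h1 h2 h3
    have hη0 : 0 ≤ η n := div_nonneg (hρ.nonneg n) (by positivity)
    refine le_trans (measure_mono ?_) ((sampleLaw_norm_sub_gt_le h3 (hS n) hη0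
      (by linarith)).trans (ENNReal.ofReal_le_ofReal h2))
    intro X hX
    have hX' := (Set.mem_compl_iff _ _).1 hX
    rw [Set.mem_ofPred_eq, not_le] at hX'
    exact hX'
  · have hsmall : ∀ᶠ n in atTop, (B + 1 + K) * ρ n ≤ 786432 * K := by
      have h := hρ.tendsto_zero.const_mul (B + 1 + K)
      rw [mul_zero] at h
      filter_upwards [h.eventually (gt_mem_nhds (by positivity : (0 : ℝ) < 786432 * K))] with n hn
      exact hn.le
    filter_upwards [hη1, hexp, eventually_gt_atTop 0, hρ.eventually_pos, hρ.le_mul_sq, hSK, hbB,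
      hsmall] with n h1 h2 h3 h4 h5 h6 h7 h8 X hX
    have hη0 : 0 < η n := div_pos h4 (by positivity)
    have hp1 : (1 : ℝ) ≤ p n := by exact_mod_cast hp n
    -- `p n` is of smaller order than `η n * n`
    have hmain : (B + 1 + K) * p n ≤ η n * n := by
      have e1 : (B + 1 + K) * (9437184 * K ^ 2 * p n) ≤ (B + 1 + K) * (n * ρ n ^ 2) :=
        mul_le_mul_of_nonneg_left h5 (by positivity)
      have e2 : (B + 1 + K) * ρ n * (n * ρ n) ≤ 786432 * K * (n * ρ n) :=
        mul_le_mul_of_nonneg_right h8 (by positivity)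
      simp only [hη]
      rw [div_mul_eq_mul_div, le_div_iff₀ (by positivity)]
      have e3 : 786432 * K * ((B + 1 + K) * p n * (12 * K)) ≤ 786432 * K * (ρ n * n) := by
        linarith
      exact le_of_mul_le_mul_left e3 (by positivity)
    have hKn : K ≤ η n * n := by nlinarith
    have hbn : (b n : ℝ) + p n ≤ η n * n := by nlinarith
    have h := one_sub_le_posterior_covBall X (hb n) (hS n) h3 hη0 h1 hK0.le h6.1 h6.2 hKn hbn hX
    have hr : 6 * η n * K = ρ n / 2 := by
      simp only [hη]
      field_simp
      norm_num
    rw [hr] at h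
    linarith

/-- Posterior concentration on covariance balls, and the negligibility of symmetric shifts of
Frobenius norm `O(n ^ (-1/2))`. -/
theorem tendstoInSampleProb_covBall {p : ℕ → ℕ} (hp : ∀ n, 0 < p n)
    (hpn : Tendsto (fun n : ℕ => (p n : ℝ) / n) atTop (𝓝 0)) {S : ∀ n, RMat (p n)}
    (hS : ∀ n, (S n).PosDef) {b : ℕ → ℤ} (hb : ∀ n, 1 ≤ b n) {K B : ℝ} (hK : 1 ≤ K)
    (hSK : ∀ᶠ n in atTop, ‖S n‖ ≤ K ∧ ‖(S n)⁻¹‖ ≤ K) (hB : 1 ≤ B)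
    (hbB : ∀ᶠ n in atTop, (b n : ℝ) ≤ B) {ρ : ℕ → ℝ}
    (hρ : AdmissibleRadius p (9437184 * K ^ 2) ρ) :
    TendstoInSampleProb p S (fun n X => posterior (wishart (p n) (b n)) X
      (covBall (S n) (ρ n))) 1 ∧
    ∀ (D : ∀ n, RMat (p n)) (C : ℝ), (∀ n, (D n).IsSymm) →
      (∀ᶠ n : ℕ in atTop, frobNorm (D n) ≤ C / Real.sqrt n) →
      TendstoInSampleProb p S (fun n X => shiftRatio (wishart (p n) (b n)) X
        (covBall (S n) (ρ n)) (D n)) 1 := by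
  have hK0 : 0 < K := by linarith
  obtain ⟨E, τ, hτ0, hE, hpost⟩ :=
    exists_posterior_covBall_bound hp hS hb hK hSK hB hbB hρ
  have hmono : ∀ (n : ℕ) (X : Sample n (p n)),
      posterior (wishart (p n) (b n)) X (covBall (S n) (ρ n / 2)) ≤
        posterior (wishart (p n) (b n)) X (covBall (S n) (ρ n)) := fun n X =>
    posterior_wishart_mono X (hb n) (measurableSet_covBall _ _) (measurableSet_covBall _ _)
      (covBall_mono _ (by linarith [hρ.nonneg n]))
  have hτ1 : Tendsto (fun n => 1 - τ n) atTop (𝓝 1) := by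
    have := hτ0.const_sub 1
    rwa [sub_zero] at this
  constructor
  · refine TendstoInSampleProb.of_bounds E hE hτ1 tendsto_const_nhds ?_
    filter_upwards [hpost] with n hn X hX
    exact ⟨(hn X hX).trans (hmono n X),
      posterior_wishart_le_one X (hb n) (measurableSet_covBall _ _)⟩
  · intro D C hD hDC
    have hsqrt : Tendsto (fun n : ℕ => Real.sqrt n) atTop atTop :=
      Real.tendsto_sqrt_atTop.comp tendsto_natCast_atTop_atTop
    set δ : ℕ → ℝ := fun n => C / Real.sqrt n with hδ
    have hδ0 : Tendsto δ atTop (𝓝 0) := hsqrt.const_div_atTop C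
    set ε : ℕ → ℝ := fun n => Real.sqrt (p n) * δ n * (4 * K * B + 1) with hε
    have hε0 : Tendsto ε atTop (𝓝 0) := by
      have h1 : ε = fun n : ℕ => Real.sqrt ((p n : ℝ) / n) * (C * (4 * K * B + 1)) := by
        funext n
        simp only [hε, hδ]
        rw [Real.sqrt_div (Nat.cast_nonneg _)]
        ring
      have h2 := ((Real.continuous_sqrt.tendsto 0).comp hpn).mul_const (C * (4 * K * B + 1))
      rw [Real.sqrt_zero, zero_mul] at h2
      rw [h1]
      exact h2
    have hlo : Tendsto (fun n => Real.exp (-ε n) * (1 - τ n)) atTop (𝓝 1) := by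
      have := ((Real.continuous_exp.tendsto _).comp hε0.neg).mul hτ1
      simpa using this
    have hhi : Tendsto (fun n => Real.exp (ε n) / (1 - τ n)) atTop (𝓝 1) := by
      have := ((Real.continuous_exp.tendsto _).comp hε0).div hτ1 one_ne_zero
      rw [Real.exp_zero, div_one] at this
      exact this
    refine TendstoInSampleProb.of_bounds E hE hlo hhi ?_
    have hδρ : ∀ᶠ n in atTop, 8 * K ^ 2 * δ n ≤ ρ n / 2 := by
      have h1 : Tendsto (fun n : ℕ => Real.sqrt n * ρ n) atTop atTop := by
        have h2 := Real.tendsto_sqrt_atTop.comp hρ.tendsto_atTop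
        refine h2.congr fun n => ?_
        simp only [Function.comp_apply]
        rw [Real.sqrt_mul (Nat.cast_nonneg n), Real.sqrt_sq (hρ.nonneg n)]
      filter_upwards [h1.eventually_ge_atTop (16 * K ^ 2 * C), eventually_gt_atTop 0] with n h2 h3
      have h4 : 0 < Real.sqrt n := Real.sqrt_pos.2 (by exact_mod_cast h3)
      simp only [hδ]
      rw [← mul_div_assoc, div_le_iff₀ h4]
      linarith
    filter_upwards [hpost, hDC, hδρ, hSK, hbB,
      hτ0.eventually (gt_mem_nhds one_pos),
      hρ.tendsto_zero.eventually (gt_mem_nhds hK0),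
      hδ0.eventually (gt_mem_nhds (by positivity : 0 < 1 / (4 * K)))]
      with n h1 h2 h3 h4 h5 h6 h7 h8 X hX
    have hP1 := h1 X hX
    have hP2 := hP1.trans (hmono n X)
    have hb1 : (1 : ℝ) ≤ b n := by exact_mod_cast hb n
    have hβ : |((b n : ℝ) - 2) / 2| ≤ B := abs_le.2 ⟨by linarith, by linarith⟩
    obtain ⟨hl, hu⟩ := shiftRatio_wishart_bounds X (hb n) hK0 h4.1 h7.le (hD n) h2 h8.le h3 hβ
      (by linarith)
    refine ⟨le_trans ?_ hl, hu.trans ?_⟩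
    · exact mul_le_mul_of_nonneg_left hP1 (Real.exp_nonneg _)
    · exact div_le_div_of_nonneg_left (Real.exp_nonneg _) (by linarith) hP2

theorem admissibleRadius_sqrt {p : ℕ → ℕ} (hp : ∀ n, 0 < p n) (L : ℝ) {x : ℕ → ℝ}
    (hx : ∀ n, (p n : ℝ) / n ≤ x n) (hx0 : Tendsto x atTop (𝓝 0)) :
    AdmissibleRadius p L fun n => Real.sqrt ((p n : ℝ) / n / Real.sqrt (x n)) := by
  have hxn : ∀ n, 0 ≤ x n := fun n => le_trans (by positivity) (hx n)
  have hsq : Tendsto (fun n => Real.sqrt (x n)) atTop (𝓝 0) := by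
    have := (Real.continuous_sqrt.tendsto 0).comp hx0
    rwa [Real.sqrt_zero] at this
  have hpos : ∀ᶠ n in atTop, 0 < x n := by
    filter_upwards [eventually_gt_atTop 0] with n hn
    have h1 : (0 : ℝ) < p n := by exact_mod_cast hp n
    have h2 : (0 : ℝ) < n := by exact_mod_cast hn
    exact (div_pos h1 h2).trans_le (hx n)
  have hval : ∀ᶠ n : ℕ in atTop,
      (n : ℝ) * Real.sqrt ((p n : ℝ) / n / Real.sqrt (x n)) ^ 2 = p n * (Real.sqrt (x n))⁻¹ := by
    filter_upwards [eventually_gt_atTop 0] with n hn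
    have h2 : (n : ℝ) ≠ 0 := by exact_mod_cast hn.ne'
    rw [Real.sq_sqrt (by positivity)]
    field_simp
  have hinv : Tendsto (fun n => (Real.sqrt (x n))⁻¹) atTop atTop := by
    refine Tendsto.inv_tendsto_nhdsGT_zero ?_
    refine tendsto_nhdsWithin_iff.2 ⟨hsq, ?_⟩
    filter_upwards [hpos] with n hn
    exact Real.sqrt_pos.2 hn
  have hge : ∀ c : ℝ, ∀ᶠ n : ℕ in atTop,
      c * p n ≤ n * Real.sqrt ((p n : ℝ) / n / Real.sqrt (x n)) ^ 2 := by
    intro c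
    filter_upwards [hval, hinv.eventually_ge_atTop c] with n h1 h2
    rw [h1, mul_comm]
    exact mul_le_mul_of_nonneg_left h2 (Nat.cast_nonneg _)
  refine ⟨fun n => Real.sqrt_nonneg _, ?_, ?_, hge L⟩
  · have h1 : Tendsto (fun n => Real.sqrt (Real.sqrt (x n))) atTop (𝓝 0) := by
      have := (Real.continuous_sqrt.tendsto 0).comp hsq
      rwa [Real.sqrt_zero] at this
    refine tendsto_of_tendsto_of_tendsto_of_le_of_le tendsto_const_nhds h1
      (fun n => Real.sqrt_nonneg _) fun n => Real.sqrt_le_sqrt ?_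
    calc (p n : ℝ) / n / Real.sqrt (x n) ≤ x n / Real.sqrt (x n) :=
          div_le_div_of_nonneg_right (hx n) (Real.sqrt_nonneg _)
      _ = Real.sqrt (x n) := Real.div_sqrt
  · refine tendsto_atTop.2 fun c => ?_
    filter_upwards [hge |c|] with n hn
    refine (le_abs_self c).trans (le_trans ?_ hn)
    have h1 : (1 : ℝ) ≤ p n := by exact_mod_cast hp n
    nlinarith [abs_nonneg c]

theorem admissibleRadius_mul_sqrt {p : ℕ → ℕ} (hptop : Tendsto p atTop atTop)
    (hpn : Tendsto (fun n : ℕ => (p n : ℝ) / n) atTop (𝓝 0)) {L : ℝ} (hL : 0 < L) :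
    AdmissibleRadius p L fun n => Real.sqrt L * Real.sqrt ((p n : ℝ) / n) := by
  have hval : ∀ᶠ n : ℕ in atTop,
      (n : ℝ) * (Real.sqrt L * Real.sqrt ((p n : ℝ) / n)) ^ 2 = L * p n := by
    filter_upwards [eventually_gt_atTop 0] with n hn
    have h2 : (n : ℝ) ≠ 0 := by exact_mod_cast hn.ne'
    rw [mul_pow, Real.sq_sqrt hL.le, Real.sq_sqrt (by positivity)]
    field_simp
  refine ⟨fun n => by positivity, ?_, ?_, ?_⟩
  · have := ((Real.continuous_sqrt.tendsto 0).comp hpn).const_mul (Real.sqrt L)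
    rw [Real.sqrt_zero, mul_zero] at this
    exact this
  · have h := (tendsto_natCast_atTop_atTop (R := ℝ)).comp hptop
    refine (h.const_mul_atTop hL).congr' ?_
    filter_upwards [hval] with n hn
    exact hn.symm
  · filter_upwards [hval] with n hn
    exact hn.ge

/-! ### The two families of shifts -/

theorem isSymm_conj {d : ℕ} {A Ψ : RMat d} (hA : A.IsSymm) (hΨ : Ψ.IsSymm) :
    (A * Ψ * A).IsSymm := by
  rw [Matrix.IsSymm, Matrix.transpose_mul, Matrix.transpose_mul, hA.eq, hΨ.eq, mul_assoc]

theorem frobNorm_conj_le {d : ℕ} (A B : RMat d) : frobNorm (A * B * A) ≤ ‖A‖ * ‖A‖ * frobNorm B := by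
  refine (frobNorm_mul_le' _ _).trans ?_
  have := mul_le_mul_of_nonneg_right (frobNorm_mul_le A B) (norm_nonneg A)
  linarith

theorem frobNorm_le_norm_inv_mul_frobNorm_conj {d : ℕ} {S : RMat d} (hS : S.PosDef) (Φ : RMat d) :
    frobNorm Φ ≤ ‖S⁻¹‖ * frobNorm (CFC.sqrt S * Φ * CFC.sqrt S) := by
  set R := CFC.sqrt S with hR
  have hu : IsUnit R.det := hS.sqrt.isUnit_det_real
  have h1 : R⁻¹ * (R * Φ * R) * R⁻¹ = Φ := by
    rw [mul_assoc R, ← mul_assoc R⁻¹, Matrix.nonsing_inv_mul _ hu, one_mul, mul_assoc,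
      Matrix.mul_nonsing_inv _ hu, mul_one]
  have h2 : ‖R⁻¹‖ * ‖R⁻¹‖ = ‖S⁻¹‖ := by
    rw [hR, hS.posSemidef.inv_sqrt]
    exact hS.inv.norm_sqrt_mul_self
  have := frobNorm_conj_le R⁻¹ (R * Φ * R)
  rwa [h1, h2] at this

theorem frobNorm_conj_le_norm_mul_frobNorm_conj_sqrt {d : ℕ} {A : RMat d} (hA : A.PosDef)
    (Ψ : RMat d) : frobNorm (A * Ψ * A) ≤ ‖A‖ * frobNorm (CFC.sqrt A * Ψ * CFC.sqrt A) := by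
  have h1 : A * Ψ * A
      = CFC.sqrt A * (CFC.sqrt A * Ψ * CFC.sqrt A) * CFC.sqrt A := by
    conv_lhs => rw [← hA.sqrt_mul_self]
    simp only [mul_assoc]
  rw [h1, ← hA.norm_sqrt_mul_self]
  exact frobNorm_conj_le _ _

theorem frobNorm_scaled_le {d : ℕ} {M : RMat d} {f t k K : ℝ} (n : ℕ) (hf : 0 ≤ f)
    (hM : frobNorm M ≤ k * f) (hk : k ≤ K) (hk0 : 0 ≤ k) :
    frobNorm ((Real.sqrt 2 * t / (Real.sqrt n * f)) • M)
      ≤ (Real.sqrt 2 * |t| * K) / Real.sqrt n := by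
  rw [frobNorm_smul, abs_div, abs_mul, abs_of_nonneg (Real.sqrt_nonneg 2),
    abs_of_nonneg (mul_nonneg (Real.sqrt_nonneg _) hf)]
  refine (mul_le_mul_of_nonneg_left hM (by positivity)).trans ?_
  rcases hf.eq_or_lt with h | h
  · rw [← h]
    have : 0 ≤ K := hk0.trans hk
    simp only [mul_zero]
    positivity
  · rcases (Real.sqrt_nonneg (n : ℝ)).eq_or_lt with hn | hn
    · rw [← hn]
      simp
    · rw [div_mul_eq_mul_div, div_le_div_iff₀ (by positivity) hn]
      have : Real.sqrt 2 * |t| * f * Real.sqrt n * k ≤ Real.sqrt 2 * |t| * f * Real.sqrt n * K :=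
        mul_le_mul_of_nonneg_left hk (by positivity)
      linarith

theorem mainTheorem3
    (p : ℕ → ℕ) (hp_pos : ∀ n, 0 < p n)
    (hpn : (fun n : ℕ => (p n : ℝ) / n) =o[atTop] fun _ => (1 : ℝ))
    (S : ∀ n, RMat (p n)) (hS : ∀ n, (S n).PosDef)
    (hS_bdd : (fun n => max ‖S n‖ ‖(S n)⁻¹‖) =O[atTop] fun _ => (1 : ℝ))
    (b : ℕ → ℤ) (hb_pos : ∀ n, 1 ≤ b n)
    (hb : (fun n => (b n : ℝ)) =O[atTop] fun _ => (1 : ℝ)) :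
    -- the two conditions hold for some sets `A n`
    (∃ A : ∀ n, Set (RMat (p n)),
      ∀ Φ : ∀ n, RMat (p n), (∀ n, (Φ n).IsSymm) → (∀ n, Φ n ≠ 0) →
        CovarianceConditions p S (fun n => wishart (p n) (b n)) A Φ) ∧
    (∀ r : ℕ → ℕ, (∀ n, 0 < r n) →
      (fun n : ℕ => (r n : ℝ) * (p n : ℝ) ^ 2 / n) =o[atTop] (fun _ => (1 : ℝ)) →
      ∃ A : ∀ n, Set (RMat (p n)),
        ∀ Ψ : ∀ n, RMat (p n), (∀ n, (Ψ n).IsSymm) → (∀ n, Ψ n ≠ 0) →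
          (∀ n, (Ψ n).rank ≤ r n) →
          PrecisionConditions p r S (fun n => wishart (p n) (b n)) A Ψ) ∧
    -- as `n` and `p` tend to infinity jointly, they hold for these explicit sets `A n`
    (Tendsto p atTop atTop → ∃ M : ℝ, 0 < M ∧
      (∀ Φ : ∀ n, RMat (p n), (∀ n, (Φ n).IsSymm) → (∀ n, Φ n ≠ 0) →
        CovarianceConditions p S (fun n => wishart (p n) (b n))
          (fun n => covBall (S n) (M * Real.sqrt ((p n : ℝ) / n))) Φ) ∧
      (∀ r : ℕ → ℕ, (∀ n, 0 < r n) →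
        (fun n : ℕ => (r n : ℝ) * (p n : ℝ) ^ 2 / n) =o[atTop] (fun _ => (1 : ℝ)) →
        ∀ Ψ : ∀ n, RMat (p n), (∀ n, (Ψ n).IsSymm) → (∀ n, Ψ n ≠ 0) →
          (∀ n, (Ψ n).rank ≤ r n) →
          PrecisionConditions p r S (fun n => wishart (p n) (b n))
            (fun n => covBall (S n) (M * Real.sqrt ((p n : ℝ) / n))) Ψ)) := by
  have hpn0 : Tendsto (fun n : ℕ => (p n : ℝ) / n) atTop (𝓝 0) := (isLittleO_one_iff ℝ).1 hpn
  obtain ⟨K, hK, hSK⟩ : ∃ K : ℝ, 1 ≤ K ∧ ∀ᶠ n in atTop, ‖S n‖ ≤ K ∧ ‖(S n)⁻¹‖ ≤ K := by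
    obtain ⟨c, hc⟩ := hS_bdd.bound
    refine ⟨max c 1, le_max_right _ _, ?_⟩
    filter_upwards [hc] with n hn
    rw [norm_one, mul_one] at hn
    have h := (le_abs_self _).trans (hn.trans (le_max_left c 1))
    exact ⟨(le_max_left _ _).trans h, (le_max_right _ _).trans h⟩
  obtain ⟨B, hB, hbB⟩ : ∃ B : ℝ, 1 ≤ B ∧ ∀ᶠ n in atTop, (b n : ℝ) ≤ B := by
    obtain ⟨c, hc⟩ := hb.bound
    refine ⟨max c 1, le_max_right _ _, ?_⟩
    filter_upwards [hc] with n hn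
    rw [norm_one, mul_one] at hn
    exact (le_abs_self _).trans (hn.trans (le_max_left c 1))
  have hcov : ∀ ρ : ℕ → ℝ, AdmissibleRadius p (9437184 * K ^ 2) ρ →
      ∀ Φ : ∀ n, RMat (p n), (∀ n, (Φ n).IsSymm) →
        CovarianceConditions p S (fun n => wishart (p n) (b n))
          (fun n => covBall (S n) (ρ n)) Φ := by
    intro ρ hρ Φ hΦ
    obtain ⟨h1, h2⟩ := tendstoInSampleProb_covBall hp_pos hpn0 hS hb_pos hK hSK hB hbB hρ
    refine ⟨⟨ρ, hρ.tendsto_zero, fun n => subset_rfl⟩, h1, fun t => ?_⟩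
    refine h2 _ (Real.sqrt 2 * |t| * K) (fun n => (hΦ n).smul _) ?_
    filter_upwards [hSK] with n hn
    exact frobNorm_scaled_le n (frobNorm_nonneg _)
      (frobNorm_le_norm_inv_mul_frobNorm_conj (hS n) (Φ n)) hn.2 (norm_nonneg _)
  have hprec : ∀ r : ℕ → ℕ, ∀ ρ : ℕ → ℝ, AdmissibleRadius p (9437184 * K ^ 2) ρ →
      Tendsto (fun n => Real.sqrt ((r n : ℝ) * p n) * ρ n) atTop (𝓝 0) →
      ∀ Ψ : ∀ n, RMat (p n), (∀ n, (Ψ n).IsSymm) →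
        PrecisionConditions p r S (fun n => wishart (p n) (b n))
          (fun n => covBall (S n) (ρ n)) Ψ := by
    intro r ρ hρ hr Ψ hΨ
    obtain ⟨h1, h2⟩ := tendstoInSampleProb_covBall hp_pos hpn0 hS hb_pos hK hSK hB hbB hρ
    refine ⟨⟨_, hr, fun n Ω hΩ => ⟨hΩ.1, mul_le_mul_of_nonneg_left hΩ.2 (Real.sqrt_nonneg _)⟩⟩,
      h1, fun t => ?_⟩
    refine h2 _ (Real.sqrt 2 * |t| * K)
      (fun n => ((isSymm_conj (hS n).inv.isSymm_real (hΨ n)).smul _).neg) ?_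
    filter_upwards [hSK] with n hn
    rw [frobNorm_neg]
    exact frobNorm_scaled_le n (frobNorm_nonneg _)
      (frobNorm_conj_le_norm_mul_frobNorm_conj_sqrt (hS n).inv (Ψ n)) hn.2 (norm_nonneg _)
  refine ⟨⟨_, fun Φ hΦ _ => hcov _ (admissibleRadius_sqrt hp_pos _ (fun n => le_rfl) hpn0) Φ hΦ⟩,
    fun r hr hrp => ?_, fun hptop => ?_⟩
  · have hx0 := (isLittleO_one_iff ℝ).1 hrp
    have hx : ∀ n : ℕ, (p n : ℝ) / n ≤ (r n : ℝ) * (p n : ℝ) ^ 2 / n := by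
      intro n
      refine div_le_div_of_nonneg_right ?_ (Nat.cast_nonneg n)
      have h1 : (1 : ℝ) ≤ r n := by exact_mod_cast hr n
      have h2 : (1 : ℝ) ≤ p n := by exact_mod_cast hp_pos n
      nlinarith
    refine ⟨_, fun Ψ hΨ _ _ => hprec r _ (admissibleRadius_sqrt hp_pos _ hx hx0) ?_ Ψ hΨ⟩
    -- `√(r p) ρ = (r p ^ 2 / n) ^ (1/4)`
    have hval : ∀ n : ℕ, Real.sqrt ((r n : ℝ) * p n) * Real.sqrt ((p n : ℝ) / n /
        Real.sqrt ((r n : ℝ) * (p n : ℝ) ^ 2 / n))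
          = Real.sqrt (Real.sqrt ((r n : ℝ) * (p n : ℝ) ^ 2 / n)) := by
      intro n
      rw [← Real.sqrt_mul (by positivity)]
      congr 1
      conv_rhs => rw [← Real.div_sqrt]
      ring
    simp only [hval]
    have := ((Real.continuous_sqrt.comp Real.continuous_sqrt).tendsto 0).comp hx0
    rw [Function.comp_apply, Real.sqrt_zero, Real.sqrt_zero] at this
    exact this
  · refine ⟨Real.sqrt (9437184 * K ^ 2), Real.sqrt_pos.2 (by positivity), fun Φ hΦ _ => ?_,
      fun r hr hrp Ψ hΨ _ _ => ?_⟩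
    · exact hcov _ (admissibleRadius_mul_sqrt hptop hpn0 (by positivity)) Φ hΦ
    · refine hprec r _ (admissibleRadius_mul_sqrt hptop hpn0 (by positivity)) ?_ Ψ hΨ
      have hx0 := (isLittleO_one_iff ℝ).1 hrp
      have hval : ∀ n : ℕ, Real.sqrt ((r n : ℝ) * p n) * (Real.sqrt (9437184 * K ^ 2) *
          Real.sqrt ((p n : ℝ) / n)) = Real.sqrt (9437184 * K ^ 2) *
          Real.sqrt ((r n : ℝ) * (p n : ℝ) ^ 2 / n) := by
        intro n
        rw [mul_left_comm, ← Real.sqrt_mul (by positivity)]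
        congr 2
        ring
      simp only [hval]
      have := ((Real.continuous_sqrt.tendsto 0).comp hx0).const_mul (Real.sqrt (9437184 * K ^ 2))
      simpa using this
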